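/- **Setting.** Consider the plant $$\dot x = Ax+Bu+Pw,\qquad e = C_e x+Q_e w,\qquad y_{\rm r}=C_{\rm r}x+Q_{\rm r}w,$$ with $x\in\mathbb R^n$, $u\in\mathbb R^m$, $e\in\mathbb R^q$, $y_{\rm r}\in\mathbb R^{p-q}$, and $w\in\mathbb R^l$ generated by the exosystem $\dot w=Sw$. Put $C=\operatorname{col}(C_e,C_{\rm r})$. Assume that $S$ is neutrally stable (all roots of its minimal polynomial are simple and lie on the imaginary axis), that $(A,B)$ is controllable and $(C,A)$ is observable, and that the non-resonance condition $\operatorname{rank}\begin{bmatrix}A-sI_n&B\\C_e&0\end{bmatrix}=n+q$ holds for all $s\in\sigma(S)$. **Tuning.** Let $F\in\mathbb R^{\mu\times\mu}$, $G\in\mathbb R^{\mu\times m}$, $L=[L_e\;\,L_{\rm r}]\in\mathbb R^{\mu\times(q+(p-q))}$ define a canonical non-minimal realization of $(A,B,C)$: $F$ is Hurwitz and there are matrices $\Pi,H$ with $\Pi(F+LH)=A\Pi$, $\Pi G=B$, $H=C\Pi$. Let $H_e=C_e\Pi$. Let $S_0\in\mathbb R^{d\times d}$ and $F_0\in\mathbb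 R^{\delta\times\delta}$ be the companion matrices (ones on the superdiagonal, last row $(-\theta_0,-\theta_1,\dots)$) of the minimal polynomials of $S$ and of $F$, of degrees $d$ and $\delta$. Let $\Gamma_0=\operatorname{col}(0,\dots,0,\omega_s)\in\mathbb R^d$ and $G_0=\operatorname{col}(0,\dots,0,\omega_f)\in\mathbb R^\delta$ with $\omega_s,\omega_f\neq0$, and set $\Phi=I_q\otimes S_0$, $\Gamma=I_q\otimes\Gamma_0$. **Data.** Let $(u(t),e(t),y_{\rm r}(t))$, $t\in[0,\tau]$, $\tau>0$, be collected in one experiment on the plant driven by some trajectory $w$ of the exosystem. On $[0,\tau]$, let $$\dot{\hat\zeta}=F\hat\zeta+Gu+L_ee+L_{\rm r}y_{\rm r},\ \ \hat\zeta(0)=0;\qquad \dot\eta=\Phi\eta+\Gamma e,\ \ \eta(0)=0;\qquad \dot\chi=\begin{bmatrix}S_0&0\\0&F_0\end{bmatrix}\chi,\ \ \chi(0)=\operatorname{col}(\Gamma_0,G_0).$$ For $N\ge1$ let $\mathcal U,\mathcal X,\mathcal Z,\dot{\mathcal Z}$ be the matrices whose $N$ columns are the values of $u$, $\chi$, $\operatorname{col}(\hat\zeta,\eta)$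 and $\operatorname{col}(\dot{\hat\zeta},\dot\eta)$ at the times $k\tau/N$, $k=0,\dots,N-1$. Consider the linear matrix inequality in $\mathcal P\in\mathbb R^{(\mu+dq)\times(\mu+dq)}$, $\mathcal Q\in\mathbb R^{N\times(\mu+dq)}$: $$\mathcal P=\mathcal P^\top\succ0,\qquad \dot{\mathcal Z}\mathcal Q+\mathcal Q^\top\dot{\mathcal Z}^\top\prec0,\qquad \begin{bmatrix}0_{(d+\delta)\times(\mu+dq)}\\\mathcal P\end{bmatrix}=\begin{bmatrix}\mathcal X\\\mathcal Z\end{bmatrix}\mathcal Q.\tag{LMI}$$ **Theorem.** 1. The (LMI) is feasible if $$\operatorname{rank}\begin{bmatrix}\mathcal X\\\mathcal Z\\\mathcal U\end{bmatrix}=(d+\delta)+(\mu+dq)+m.$$ 2. For every solution $(\mathcal P,\mathcal Q)$ of (LMI), the gain $K=[K_\zeta\;\,K_\eta]=\mathcal U\mathcal Q\mathcal P^{-1}$, with $K_\zeta\in\mathbb R^{m\times\mu}$ and $K_\eta\in\mathbb R^{m\times dq}$, is such that $$\begin{bmatrix}F+LH&0\\\Gamma H_e&\Phi\end{bmatrix}+\begin{bmatrix}G\\0\end{bmatrix}K$$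 is Hurwitz, and the controller $$\dot\xi=\begin{bmatrix}F+GK_\zeta&GK_\eta\\0&\Phi\end{bmatrix}\xi+\begin{bmatrix}L_e&L_{\rm r}\\\Gamma&0\end{bmatrix}\begin{bmatrix}e\\y_{\rm r}\end{bmatrix},\qquad u=K\xi,$$ solves the output regulation problem: if $w=0$, the origin $(x,\xi)=0$ of the closed loop is globally exponentially stable; and for every solution $w$ of $\dot w=Sw$ and all initial conditions of plant and controller, $\lim_{t\to\infty}e(t)=0$. -/

import Mathlib

open Matrix Filter Topology
open scoped Kronecker

noncomputable section

namespace DataDrivenRegulation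

/-! ### Linear-algebraic notions -/

/-- The spectrum of a real square matrix: the set of its complex eigenvalues. -/
def sigma {ι : Type*} [Fintype ι] [DecidableEq ι] (M : Matrix ι ι ℝ) : Set ℂ :=
  spectrum ℂ (M.map (algebraMap ℝ ℂ))

/-- A real square matrix is Hurwitz if all its eigenvalues have negative real part. -/
def IsHurwitz {ι : Type*} [Fintype ι] [DecidableEq ι] (M : Matrix ι ι ℝ) : Prop :=
  ∀ s ∈ sigma M, s.re < 0

/-- Neutral stability: all complex roots of the minimal polynomial lie on the imaginary axis
and are simple. -/
def IsNeutrallyStable {ι : Type*} [Fintype ι] [DecidableEq ι] (S : Matrix ι ι ℝ) : Prop :=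
  ∀ s : ℂ, ((minpoly ℝ S).map (algebraMap ℝ ℂ)).IsRoot s →
    s.re = 0 ∧ ((minpoly ℝ S).map (algebraMap ℝ ℂ)).rootMultiplicity s = 1

/-- The controllability matrix `[B  A B  ⋯  A^(n-1) B]`. -/
def controllabilityMatrix {n : ℕ} {β : Type*} (A : Matrix (Fin n) (Fin n) ℝ)
    (B : Matrix (Fin n) β ℝ) : Matrix (Fin n) (Fin n × β) ℝ :=
  Matrix.of fun i kj => (A ^ (kj.1 : ℕ) * B) i kj.2

/-- The pair `(A, B)` is controllable (Kalman rank condition). -/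
def IsControllable {n : ℕ} {β : Type*} [Fintype β] (A : Matrix (Fin n) (Fin n) ℝ)
    (B : Matrix (Fin n) β ℝ) : Prop :=
  (controllabilityMatrix A B).rank = n

/-- The observability matrix, with block rows `C`, `C A`, …, `C A^(n-1)`. -/
def observabilityMatrix {n : ℕ} {γ : Type*} (C : Matrix γ (Fin n) ℝ)
    (A : Matrix (Fin n) (Fin n) ℝ) : Matrix (Fin n × γ) (Fin n) ℝ :=
  Matrix.of fun ki j => (C * A ^ (ki.1 : ℕ)) ki.2 j

/-- The pair `(C, A)` is observable (Kalman rank condition). -/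
def IsObservable {n : ℕ} {γ : Type*} (C : Matrix γ (Fin n) ℝ)
    (A : Matrix (Fin n) (Fin n) ℝ) : Prop :=
  (observabilityMatrix C A).rank = n

/-- The degree of the minimal polynomial of a real square matrix. -/
def minDeg {k : ℕ} (M : Matrix (Fin k) (Fin k) ℝ) : ℕ := (minpoly ℝ M).natDegree

/-- The companion matrix of the minimal polynomial `s^d + θ_{d-1} s^(d-1) + ⋯ + θ_0` of `M`:
ones on the superdiagonal and last row `(-θ_0, …, -θ_{d-1})`. -/
def minCompanion {k : ℕ} (M : Matrix (Fin k) (Fin k) ℝ) :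
    Matrix (Fin (minDeg M)) (Fin (minDeg M)) ℝ :=
  Matrix.of fun i j =>
    if (i : ℕ) + 1 = minDeg M then -(minpoly ℝ M).coeff j
    else if (j : ℕ) = (i : ℕ) + 1 then 1 else 0

/-- The column vector `col(0, …, 0, ω)` of length `d`. -/
def lastVec (d : ℕ) (ω : ℝ) : Fin d → ℝ := fun i => if (i : ℕ) + 1 = d then ω else 0

/-! ### The plant and its trajectories -/

/-- The matrices of the plant
`x' = A x + B u + P w`, `e = C_e x + Q_e w`, `y_r = C_r x + Q_r w`, with `n` states, `m` inputs,
`q` regulated outputs, `r` residual outputs (so `p = q + r`) and exogenous inputs in `ℝ^l`. -/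
structure Plant (n m q r l : ℕ) where
  A : Matrix (Fin n) (Fin n) ℝ
  B : Matrix (Fin n) (Fin m) ℝ
  P : Matrix (Fin n) (Fin l) ℝ
  Ce : Matrix (Fin q) (Fin n) ℝ
  Cr : Matrix (Fin r) (Fin n) ℝ
  Qe : Matrix (Fin q) (Fin l) ℝ
  Qr : Matrix (Fin r) (Fin l) ℝ

namespace Plant

variable {n m q r l : ℕ}

/-- The full output matrix `C = col(C_e, C_r)`. -/
def C (pl : Plant n m q r l) : Matrix (Fin q ⊕ Fin r) (Fin n) ℝ := Matrix.fromRows pl.Ce pl.Cr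

/-- The regulated output `e = C_e x + Q_e w`. -/
def regOut (pl : Plant n m q r l) (x : Fin n → ℝ) (w : Fin l → ℝ) : Fin q → ℝ :=
  pl.Ce *ᵥ x + pl.Qe *ᵥ w

/-- The residual output `y_r = C_r x + Q_r w`. -/
def resOut (pl : Plant n m q r l) (x : Fin n → ℝ) (w : Fin l → ℝ) : Fin r → ℝ :=
  pl.Cr *ᵥ x + pl.Qr *ᵥ w

end Plant

/-- `z` is a solution of `z'(t) = v(t)` on the interval `T`: it is continuous on `T` and its
derivative from the right is `v(t)` at every `t ∈ T` other than the right endpoint (where the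
second clause is empty).  Classical solutions are solutions in this sense, and so are the
solutions for inputs that are piecewise continuous and continuous from the right. -/
def SolvesOn {ι : Type*} [Fintype ι] (T : Set ℝ) (z v : ℝ → ι → ℝ) : Prop :=
  ContinuousOn z T ∧ ∀ t ∈ T, HasDerivWithinAt z (v t) (T ∩ Set.Ici t) t

/-- `(u, e, y_r)` is a dataset on `[0, τ]` collected in one experiment on the plant while it is
influenced by some trajectory of the exosystem `w' = S w`. -/
def IsDataset {n m q r l : ℕ} (pl : Plant n m q r l) (S : Matrix (Fin l) (Fin l) ℝ) (τ : ℝ)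
    (u : ℝ → Fin m → ℝ) (e : ℝ → Fin q → ℝ) (yr : ℝ → Fin r → ℝ) : Prop :=
  ∃ (w : ℝ → Fin l → ℝ) (x : ℝ → Fin n → ℝ),
    SolvesOn (Set.Icc 0 τ) w (fun t => S *ᵥ w t) ∧
    SolvesOn (Set.Icc 0 τ) x (fun t => pl.A *ᵥ x t + pl.B *ᵥ u t + pl.P *ᵥ w t) ∧
    (∀ t ∈ Set.Icc 0 τ, e t = pl.regOut (x t) (w t)) ∧
    (∀ t ∈ Set.Icc 0 τ, yr t = pl.resOut (x t) (w t))

/-- The non-resonance condition: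
`rank [A - s I, B; C_e, 0] = n + q` for all `s ∈ σ(S)`. -/
def NonResonance {n m q r l : ℕ} (pl : Plant n m q r l) (S : Matrix (Fin l) (Fin l) ℝ) : Prop :=
  ∀ s ∈ sigma S,
    (Matrix.fromBlocks
      (pl.A.map (algebraMap ℝ ℂ) - s • (1 : Matrix (Fin n) (Fin n) ℂ))
      (pl.B.map (algebraMap ℝ ℂ))
      (pl.Ce.map (algebraMap ℝ ℂ))
      (0 : Matrix (Fin q) (Fin m) ℂ)).rank = n + q

/-- `ζ' = (F + L H) ζ + G u`, `y = H ζ` is a canonical non-minimal realization of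
`x' = A x + B u`, `y = C x`, with `x = Π ζ`; the argument `Pi` is the matrix `Π`. -/
structure IsCanonicalRealization {n m q r l μ : ℕ} (pl : Plant n m q r l)
    (F : Matrix (Fin μ) (Fin μ) ℝ) (G : Matrix (Fin μ) (Fin m) ℝ)
    (L : Matrix (Fin μ) (Fin q ⊕ Fin r) ℝ) (H : Matrix (Fin q ⊕ Fin r) (Fin μ) ℝ)
    (Pi : Matrix (Fin n) (Fin μ) ℝ) : Prop where
  intertwine : Pi * (F + L * H) = pl.A * Pi
  input : Pi * G = pl.B
  output : H = pl.C * Pi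
  hurwitz : IsHurwitz F

/-! ### The internal model -/

/-- `Φ = I_q ⊗ S₀`, with `S₀` the companion matrix of the minimal polynomial of `S`. -/
def imPhi (q : ℕ) {l : ℕ} (S : Matrix (Fin l) (Fin l) ℝ) :
    Matrix (Fin q × Fin (minDeg S)) (Fin q × Fin (minDeg S)) ℝ :=
  (1 : Matrix (Fin q) (Fin q) ℝ) ⊗ₖ minCompanion S

/-- `Γ = I_q ⊗ Γ₀`, with `Γ₀ = col(0, …, 0, ω)`; the one-element second factor of the column
index is dropped. -/
def imGamma (q : ℕ) {l : ℕ} (S : Matrix (Fin l) (Fin l) ℝ) (ω : ℝ) :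
    Matrix (Fin q × Fin (minDeg S)) (Fin q) ℝ :=
  ((1 : Matrix (Fin q) (Fin q) ℝ) ⊗ₖ
    Matrix.replicateCol Unit (lastVec (minDeg S) ω)).submatrix id (fun j => (j, ()))

/-! ### The algorithm -/

/-- The filter of the data: `ζ' = F ζ + G u + L_e e + L_r y_r` on `[0, τ]`, `ζ(0) = 0`, where
`L = [L_e  L_r]`. -/
def IsFilterState {m q r μ : ℕ} (F : Matrix (Fin μ) (Fin μ) ℝ) (G : Matrix (Fin μ) (Fin m) ℝ)
    (L : Matrix (Fin μ) (Fin q ⊕ Fin r) ℝ) (τ : ℝ)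
    (u : ℝ → Fin m → ℝ) (e : ℝ → Fin q → ℝ) (yr : ℝ → Fin r → ℝ) (ζ : ℝ → Fin μ → ℝ) : Prop :=
  ζ 0 = 0 ∧
  SolvesOn (Set.Icc 0 τ) ζ
    (fun t => F *ᵥ ζ t + G *ᵥ u t + L.toCols₁ *ᵥ e t + L.toCols₂ *ᵥ yr t)

/-- The internal model dynamics: `η' = Φ η + Γ e` on `[0, τ]`, `η(0) = 0`. -/
def IsInternalModelState {q l : ℕ} (S : Matrix (Fin l) (Fin l) ℝ) (ωs τ : ℝ)
    (e : ℝ → Fin q → ℝ) (η : ℝ → Fin q × Fin (minDeg S) → ℝ) : Prop :=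
  η 0 = 0 ∧
  SolvesOn (Set.Icc 0 τ) η (fun t => imPhi q S *ᵥ η t + imGamma q S ωs *ᵥ e t)

/-- The auxiliary dynamics: `χ' = diag(S₀, F₀) χ` on `[0, τ]`, `χ(0) = col(Γ₀, G₀)`. -/
def IsAuxState {l μ : ℕ} (S : Matrix (Fin l) (Fin l) ℝ) (F : Matrix (Fin μ) (Fin μ) ℝ)
    (ωs ωf τ : ℝ) (χ : ℝ → Fin (minDeg S) ⊕ Fin (minDeg F) → ℝ) : Prop :=
  χ 0 = Sum.elim (lastVec (minDeg S) ωs) (lastVec (minDeg F) ωf) ∧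
  SolvesOn (Set.Icc 0 τ) χ
    (fun t => Matrix.fromBlocks (minCompanion S) 0 0 (minCompanion F) *ᵥ χ t)

/-- The batch `[z(0)  z(τ_s)  ⋯  z((N-1) τ_s)]` of samples of a signal, `τ_s = τ / N`. -/
def batch {ι : Type*} (N : ℕ) (τ : ℝ) (z : ℝ → ι → ℝ) : Matrix ι (Fin N) ℝ :=
  Matrix.of fun i k => z ((k : ℝ) * (τ / N)) i

/-- The batch of samples of the (right) derivative of a signal. -/
def batchDeriv {ι : Type*} [Fintype ι] (N : ℕ) (τ : ℝ) (z : ℝ → ι → ℝ) : Matrix ι (Fin N) ℝ :=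
  batch N τ (fun t => derivWithin z (Set.Ici t) t)

/-- `(P, Q)` is a solution of the linear matrix inequality
`P = Pᵀ ≻ 0`, `Ż Q + Qᵀ Żᵀ ≺ 0`, `col(0, P) = col(X, Z) Q`. -/
structure IsLMISolution {ι κ : Type*} [Fintype κ] {N : ℕ}
    (X : Matrix ι (Fin N) ℝ) (Z dZ : Matrix κ (Fin N) ℝ)
    (P : Matrix κ κ ℝ) (Q : Matrix (Fin N) κ ℝ) : Prop where
  symm : P = Pᵀ
  posDef : P.PosDef
  decay : (-(dZ * Q + Qᵀ * dZᵀ)).PosDef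
  eq : Matrix.fromRows (0 : Matrix ι κ ℝ) P = Matrix.fromRows X Z * Q

/-- The gain `K = U Q P⁻¹`. -/
def gain {κ : Type*} [Fintype κ] [DecidableEq κ] {m N : ℕ} (U : Matrix (Fin m) (Fin N) ℝ)
    (P : Matrix κ κ ℝ) (Q : Matrix (Fin N) κ ℝ) : Matrix (Fin m) κ ℝ :=
  U * Q * P⁻¹

/-! ### Controllers and the output regulation problem -/

/-- A dynamic output-feedback controller
`ξ' = A_c ξ + B_c col(e, y_r)`, `u = C_c ξ + D_c col(e, y_r)`, with state space `ℝ^κ`. -/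
structure Controller (κ : Type*) (m q r : ℕ) where
  Ac : Matrix κ κ ℝ
  Bc : Matrix κ (Fin q ⊕ Fin r) ℝ
  Cc : Matrix (Fin m) κ ℝ
  Dc : Matrix (Fin m) (Fin q ⊕ Fin r) ℝ

/-- `(w, x, ξ)` is, for `t ≥ 0`, a trajectory of the interconnection of the exosystem, the plant
and the controller. -/
def IsClosedLoop {n m q r l : ℕ} {κ : Type*} [Fintype κ] (pl : Plant n m q r l)
    (S : Matrix (Fin l) (Fin l) ℝ) (c : Controller κ m q r)
    (w : ℝ → Fin l → ℝ) (x : ℝ → Fin n → ℝ) (ξ : ℝ → κ → ℝ) : Prop :=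
  ∃ (u : ℝ → Fin m → ℝ) (y : ℝ → Fin q ⊕ Fin r → ℝ),
    (∀ t, y t = Sum.elim (pl.regOut (x t) (w t)) (pl.resOut (x t) (w t))) ∧
    (∀ t, u t = c.Cc *ᵥ ξ t + c.Dc *ᵥ y t) ∧
    SolvesOn (Set.Ici 0) w (fun t => S *ᵥ w t) ∧
    SolvesOn (Set.Ici 0) x (fun t => pl.A *ᵥ x t + pl.B *ᵥ u t + pl.P *ᵥ w t) ∧
    SolvesOn (Set.Ici 0) ξ (fun t => c.Ac *ᵥ ξ t + c.Bc *ᵥ y t)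

/-- The controller solves the output regulation problem: for `w = 0` the origin of the closed
loop is globally exponentially stable, and `e(t) → 0` for every trajectory of the exosystem and
all initial conditions. -/
def SolvesOutputRegulation {n m q r l : ℕ} {κ : Type*} [Fintype κ] (pl : Plant n m q r l)
    (S : Matrix (Fin l) (Fin l) ℝ) (c : Controller κ m q r) : Prop :=
  (∃ M lam : ℝ, 0 < M ∧ 0 < lam ∧
    ∀ (x : ℝ → Fin n → ℝ) (ξ : ℝ → κ → ℝ), IsClosedLoop pl S c (fun _ => 0) x ξ →
      ∀ t, 0 ≤ t → ‖(x t, ξ t)‖ ≤ M * Real.exp (-lam * t) * ‖(x 0, ξ 0)‖) ∧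
  (∀ (w : ℝ → Fin l → ℝ) (x : ℝ → Fin n → ℝ) (ξ : ℝ → κ → ℝ), IsClosedLoop pl S c w x ξ →
    Tendsto (fun t => pl.regOut (x t) (w t)) atTop (𝓝 0))

/-- The controller
`ξ' = [F + G K_ζ, G K_η; 0, Φ] ξ + [L_e, L_r; Γ, 0] col(e, y_r)`, `u = K ξ`,
where `K = [K_ζ  K_η]`. -/
def regulator {m q r l μ : ℕ} (F : Matrix (Fin μ) (Fin μ) ℝ) (G : Matrix (Fin μ) (Fin m) ℝ)
    (L : Matrix (Fin μ) (Fin q ⊕ Fin r) ℝ) (S : Matrix (Fin l) (Fin l) ℝ) (ωs : ℝ)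
    (K : Matrix (Fin m) (Fin μ ⊕ Fin q × Fin (minDeg S)) ℝ) :
    Controller (Fin μ ⊕ Fin q × Fin (minDeg S)) m q r where
  Ac := Matrix.fromBlocks (F + G * K.toCols₁) (G * K.toCols₂) 0 (imPhi q S)
  Bc := Matrix.fromBlocks L.toCols₁ L.toCols₂ (imGamma q S ωs) 0
  Cc := K
  Dc := 0

end DataDrivenRegulation

end

open DataDrivenRegulation

/-! Write `𝒜` for `augMatrix`, `ℬ` for `augInput` and `K = U Q P⁻¹`.

The data determine `𝒜` and `ℬ` as far as needed. Since `(A - ΠLC)Π = ΠF`, the mismatch `ε = x - Πζ`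
between the plant and the filter is driven by `w` alone, through the matrix `A - ΠLC`.
Controllability makes `Π` surjective, so the minimal polynomial of `F` annihilates `A - ΠLC`, which
is therefore Hurwitz. The joint system of `(ε, w)` is then annihilated by the product of the minimal
polynomials of `F` and `S`. These are coprime, so on `[0, τ]` the pair `(ε, w)` is a fixed linear
function of `χ`, whatever the unknown initial conditions. Hence the samples satisfy `dZ = 𝒜 Z + ℬ U
+ D X` for some unknown `D` (`exists_batchDeriv_eq`).

In the LMI, `X Q = 0` removes `D` and `Z Q = P` gives `dZ Q = (𝒜 + ℬ K) P`, so the LMI is a Lyapunov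
inequality for `𝒜 + ℬ K` (`IsLMISolution.isHurwitz`). Conversely, full row rank of the data lets `Q`
realize any prescribed `Z Q = P` and `U Q = Y` with `X Q = 0` (`exists_isLMISolution`). Feasibility
thus reduces to finding `P ≻ 0` and `Y` with `𝒜 P + ℬ Y` of negative form. This is possible under
the Popov-Belevitch-Hautus test, by separation of convex sets (`exists_posDef_negForm`); the test
itself follows from controllability, non-resonance and `F` Hurwitz (`augMatrix_stabilizable`).

For regulation, in the coordinates `(x - Πζ, ξ)` the closed loop is block triangular with Hurwitz
diagonal blocks. A Sylvester equation gives a steady state `V w`; its internal-model rows force the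
regulated output to vanish there (`eq_zero_of_minCompanion_mul`), and deviations from it decay
(`solvesOutputRegulation`). -/

noncomputable section

namespace DataDrivenRegulation

/-! ### Spectra, matrix polynomials and the Sylvester equation -/

section LinearAlgebra

variable {ι κ : Type*} [Fintype ι] [Fintype κ]

/-- The entrywise embedding of real matrices into complex matrices. -/
abbrev complexify {ι κ : Type*} (M : Matrix ι κ ℝ) : Matrix ι κ ℂ := M.map (algebraMap ℝ ℂ)

theorem complexify_mul {ι κ ν : Type*} [Fintype κ] (M : Matrix ι κ ℝ) (N : Matrix κ ν ℝ) :
    complexify (M * N) = complexify M * complexify N :=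
  Matrix.map_mul

theorem complexify_one {ι : Type*} [DecidableEq ι] : complexify (1 : Matrix ι ι ℝ) = 1 := by
  simp [complexify]

theorem exists_right_inverse_of_rank {𝕜 : Type*} [Field 𝕜] [DecidableEq ι]
    (M : Matrix ι κ 𝕜) (h : M.rank = Fintype.card ι) : ∃ R : Matrix κ ι 𝕜, M * R = 1 := by
  rw [← Matrix.mulVec_surjective_iff_exists_right_inverse]
  have : LinearMap.range M.mulVecLin = ⊤ := by
    apply Submodule.eq_top_of_finrank_eq
    rw [← Matrix.rank, h, Module.finrank_fintype_fun_eq_card]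
  exact LinearMap.range_eq_top.mp this

theorem eq_zero_of_vecMul_eq_zero {𝕜 : Type*} [Field 𝕜] [DecidableEq ι]
    {M : Matrix ι κ 𝕜} {R : Matrix κ ι 𝕜} (h : M * R = 1) {v : ι → 𝕜} (hv : v ᵥ* M = 0) :
    v = 0 := by
  have := congrArg (· ᵥ* R) hv
  simpa [Matrix.vecMul_vecMul, h] using this

theorem mem_sigma_iff_isRoot_charpoly [DecidableEq ι] {M : Matrix ι ι ℝ} {s : ℂ} :
    s ∈ sigma M ↔ Polynomial.aeval s M.charpoly = 0 := by
  rw [sigma, Matrix.mem_spectrum_iff_isRoot_charpoly, Matrix.charpoly_map, Polynomial.IsRoot.def,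
    Polynomial.eval_map_algebraMap]

theorem mem_sigma_iff_exists_vecMul [DecidableEq ι] {M : Matrix ι ι ℝ} {s : ℂ} :
    s ∈ sigma M ↔ ∃ v : ι → ℂ, v ≠ 0 ∧ v ᵥ* complexify M = s • v := by
  rw [sigma, spectrum.mem_iff, Matrix.isUnit_iff_isUnit_det, isUnit_iff_ne_zero, not_not,
    ← Matrix.exists_vecMul_eq_zero_iff]
  refine exists_congr fun v => and_congr_right fun _ => ?_
  rw [Matrix.vecMul_sub, sub_eq_zero, Algebra.algebraMap_eq_smul_one, Matrix.vecMul_smul,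
    Matrix.vecMul_one, eq_comm]

theorem complexify_aeval [DecidableEq ι] (M : Matrix ι ι ℝ) (p : Polynomial ℝ) :
    complexify (Polynomial.aeval M p) = Polynomial.aeval (complexify M) p := by
  have := Polynomial.aeval_algHom_apply (Algebra.ofId ℝ ℂ).mapMatrix M p
  exact this.symm

theorem vecMul_aeval [DecidableEq ι] {M : Matrix ι ι ℝ} {s : ℂ} {v : ι → ℂ}
    (h : v ᵥ* complexify M = s • v) (p : Polynomial ℝ) :
    v ᵥ* complexify (Polynomial.aeval M p) = Polynomial.aeval s p • v := by
  rw [complexify_aeval]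
  induction p using Polynomial.induction_on' with
  | add p q hp hq => simp [Matrix.vecMul_add, hp, hq, add_smul]
  | monomial k a =>
    have hk : v ᵥ* (complexify M) ^ k = s ^ k • v := by
      induction k with
      | zero => simp
      | succ k ih =>
        rw [pow_succ, ← Matrix.vecMul_vecMul, ih, Matrix.smul_vecMul, h, smul_smul, pow_succ]
    rw [Polynomial.aeval_monomial, Polynomial.aeval_monomial, mul_smul, ← hk,
      Algebra.algebraMap_eq_smul_one, smul_mul_assoc, one_mul, Matrix.vecMul_smul,
      Complex.coe_algebraMap, Complex.coe_smul]

theorem aeval_eq_zero_of_mem_sigma [DecidableEq ι] {M : Matrix ι ι ℝ} {p : Polynomial ℝ}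
    (hp : Polynomial.aeval M p = 0) {s : ℂ} (hs : s ∈ sigma M) : Polynomial.aeval s p = 0 := by
  obtain ⟨v, hv, h⟩ := mem_sigma_iff_exists_vecMul.mp hs
  have := vecMul_aeval h p
  rw [hp] at this
  have h0 : Polynomial.aeval s p • v = 0 := by rw [← this]; simp [complexify]
  exact (smul_eq_zero.mp h0).resolve_right hv

theorem mem_sigma_of_aeval_minpoly [DecidableEq ι] {M : Matrix ι ι ℝ} {s : ℂ}
    (h : Polynomial.aeval s (minpoly ℝ M) = 0) : s ∈ sigma M := by
  rw [mem_sigma_iff_isRoot_charpoly]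
  exact Polynomial.aeval_eq_zero_of_dvd_aeval_eq_zero (Matrix.minpoly_dvd_charpoly M) h

theorem IsNeutrallyStable.re_eq_zero [DecidableEq ι] {S : Matrix ι ι ℝ}
    (hS : IsNeutrallyStable S) {s : ℂ} (h : Polynomial.aeval s (minpoly ℝ S) = 0) : s.re = 0 :=
  (hS s (by rwa [Polynomial.IsRoot.def, Polynomial.eval_map_algebraMap])).1

theorem isHurwitz_of_aeval_minpoly [DecidableEq ι] [DecidableEq κ] {F : Matrix ι ι ℝ}
    (hF : IsHurwitz F) {T : Matrix κ κ ℝ} (h : Polynomial.aeval T (minpoly ℝ F) = 0) :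
    IsHurwitz T := fun s hs =>
  hF s (mem_sigma_of_aeval_minpoly (aeval_eq_zero_of_mem_sigma h hs))

/-- A common complex root would lie both on the imaginary axis and in the open left half-plane. -/
theorem isCoprime_minpoly [DecidableEq ι] [DecidableEq κ] {S : Matrix ι ι ℝ} {T : Matrix κ κ ℝ}
    (hS : IsNeutrallyStable S) (hT : IsHurwitz T) :
    IsCoprime (minpoly ℝ S) (minpoly ℝ T) := by
  rw [Polynomial.isCoprime_iff_aeval_ne_zero_of_isAlgClosed ℝ ℂ]
  intro s
  by_contra! h
  have h1 := hS.re_eq_zero h.1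
  have h2 := hT s (mem_sigma_of_aeval_minpoly h.2)
  linarith

theorem aeval_mul_eq_mul_aeval [DecidableEq ι] [DecidableEq κ] {T : Matrix ι ι ℝ}
    {V : Matrix κ κ ℝ} {M : Matrix ι κ ℝ} (h : T * M = M * V) (p : Polynomial ℝ) :
    Polynomial.aeval T p * M = M * Polynomial.aeval V p := by
  induction p using Polynomial.induction_on' with
  | add p q hp hq => simp [Matrix.add_mul, Matrix.mul_add, hp, hq]
  | monomial k a =>
    have hk : T ^ k * M = M * V ^ k := by
      induction k with
      | zero => simp
      | succ k ih => rw [pow_succ, Matrix.mul_assoc, h, ← Matrix.mul_assoc, ih, pow_succ,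
          Matrix.mul_assoc]
    simp [Polynomial.aeval_monomial, Algebra.algebraMap_eq_smul_one, hk]

/-- The Sylvester equation is solvable if the first matrix is Hurwitz and the second one is
neutrally stable. -/
theorem exists_sylvester [DecidableEq ι] [DecidableEq κ] {S : Matrix ι ι ℝ} {T : Matrix κ κ ℝ}
    (hS : IsNeutrallyStable S) (hT : IsHurwitz T) (N : Matrix κ ι ℝ) :
    ∃ M : Matrix κ ι ℝ, T * M + N = M * S := by
  let f : Matrix κ ι ℝ →ₗ[ℝ] Matrix κ ι ℝ :=
    { toFun := fun M => M * S - T * M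
      map_add' := fun M N => by rw [Matrix.add_mul, Matrix.mul_add]; abel
      map_smul' := fun c M => by simp [smul_sub] }
  -- If `T M = M S`, then with `p` the minimal polynomial of `S` also `p(T) M = M p(S) = 0`.
  -- Coprimality makes `p(T)` invertible, so `M = 0`. In finite dimension injectivity gives
  -- surjectivity.
  have hinj : Function.Injective f := by
    rw [injective_iff_map_eq_zero]
    intro M hM
    have h1 : T * M = M * S := (sub_eq_zero.mp hM).symm
    obtain ⟨a, b, hab⟩ := isCoprime_minpoly hS hT
    have h2 := congrArg (Polynomial.aeval T) hab
    rw [map_add, map_mul, map_mul, minpoly.aeval, mul_zero, add_zero, map_one] at h2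
    have h3 := aeval_mul_eq_mul_aeval h1 (minpoly ℝ S)
    rw [minpoly.aeval, Matrix.mul_zero] at h3
    rw [← Matrix.one_mul M, ← h2, Matrix.mul_assoc, h3, Matrix.mul_zero]
  obtain ⟨M, hM⟩ := LinearMap.injective_iff_surjective.mp hinj N
  exact ⟨M, by rw [← show M * S - T * M = N from hM]; abel⟩

theorem isHurwitz_fromBlocks [DecidableEq ι] [DecidableEq κ] {M : Matrix ι ι ℝ}
    {N : Matrix κ κ ℝ} (hM : IsHurwitz M) (hN : IsHurwitz N) (V : Matrix κ ι ℝ) :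
    IsHurwitz (Matrix.fromBlocks M 0 V N) := by
  intro s hs
  rw [mem_sigma_iff_isRoot_charpoly, Matrix.charpoly_fromBlocks_zero₁₂, map_mul,
    mul_eq_zero] at hs
  exact hs.elim (fun h => hM s (mem_sigma_iff_isRoot_charpoly.mpr h))
    (fun h => hN s (mem_sigma_iff_isRoot_charpoly.mpr h))

end LinearAlgebra

/-! ### Quadratic forms and the Lyapunov test -/

section Lyapunov

variable {ι κ : Type*} [Fintype ι] [Fintype κ]

theorem re_star_dotProduct_complexify_mulVec (M : Matrix ι ι ℝ) (u : ι → ℂ) :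
    (star u ⬝ᵥ complexify M *ᵥ u).re =
      (fun i => (u i).re) ⬝ᵥ M *ᵥ (fun i => (u i).re)
        + (fun i => (u i).im) ⬝ᵥ M *ᵥ (fun i => (u i).im) := by
  simp only [dotProduct, mulVec, Complex.re_sum, ← Finset.sum_add_distrib, Finset.mul_sum]
  refine Finset.sum_congr rfl fun i _ => Finset.sum_congr rfl fun j _ => ?_
  simp [complexify]

theorem im_star_dotProduct_complexify_mulVec {M : Matrix ι ι ℝ} (hM : Mᵀ = M) (u : ι → ℂ) :
    (star u ⬝ᵥ complexify M *ᵥ u).im = 0 := by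
  have h : (star u ⬝ᵥ complexify M *ᵥ u).im =
      (fun i => (u i).re) ⬝ᵥ M *ᵥ (fun i => (u i).im)
        - (fun i => (u i).im) ⬝ᵥ M *ᵥ (fun i => (u i).re) := by
    simp only [dotProduct, mulVec, Complex.im_sum, ← Finset.sum_sub_distrib, Finset.mul_sum]
    refine Finset.sum_congr rfl fun i _ => Finset.sum_congr rfl fun j _ => ?_
    simp [complexify]
    ring
  rw [h, Matrix.dotProduct_mulVec, ← Matrix.mulVec_transpose, hM, dotProduct_comm, sub_self]

theorem re_eigenvalue_mul {M N : Matrix ι ι ℝ} (hN : Nᵀ = N) {s : ℂ} {u : ι → ℂ}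
    (h : star u ⬝ᵥ complexify M *ᵥ u = s * (star u ⬝ᵥ complexify N *ᵥ u)) :
    (star u ⬝ᵥ complexify M *ᵥ u).re = s.re * (star u ⬝ᵥ complexify N *ᵥ u).re := by
  rw [h, Complex.mul_re, im_star_dotProduct_complexify_mulVec hN, mul_zero, sub_zero]

/-- The quadratic form of `M` is negative definite. -/
def NegForm (M : Matrix ι ι ℝ) : Prop := ∀ v : ι → ℝ, v ≠ 0 → v ⬝ᵥ M *ᵥ v < 0

theorem re_or_im_ne_zero {u : ι → ℂ} (hu : u ≠ 0) :
    (fun i => (u i).re) ≠ 0 ∨ (fun i => (u i).im) ≠ 0 := by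
  by_contra! h
  exact hu (funext fun i => Complex.ext (congrFun h.1 i) (congrFun h.2 i))

theorem PosDef.re_star_dotProduct_pos {P : Matrix ι ι ℝ} (hP : P.PosDef) {u : ι → ℂ}
    (hu : u ≠ 0) : 0 < (star u ⬝ᵥ complexify P *ᵥ u).re := by
  rw [re_star_dotProduct_complexify_mulVec]
  have h0 : ∀ v : ι → ℝ, 0 ≤ v ⬝ᵥ P *ᵥ v := fun v => by
    simpa using hP.posSemidef.dotProduct_mulVec_nonneg v
  have h1 : ∀ v : ι → ℝ, v ≠ 0 → 0 < v ⬝ᵥ P *ᵥ v := fun v hv => by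
    simpa using hP.dotProduct_mulVec_pos hv
  rcases re_or_im_ne_zero hu with h | h
  · linarith [h1 _ h, h0 fun i => (u i).im]
  · linarith [h1 _ h, h0 fun i => (u i).re]

theorem NegForm.re_star_dotProduct_neg {M : Matrix ι ι ℝ} (hM : NegForm M) {u : ι → ℂ}
    (hu : u ≠ 0) : (star u ⬝ᵥ complexify M *ᵥ u).re < 0 := by
  rw [re_star_dotProduct_complexify_mulVec]
  have h0 : ∀ v : ι → ℝ, v ⬝ᵥ M *ᵥ v ≤ 0 := fun v => by
    by_cases hv : v = 0
    · simp [hv]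
    · exact (hM v hv).le
  rcases re_or_im_ne_zero hu with h | h
  · linarith [hM _ h, h0 fun i => (u i).im]
  · linarith [hM _ h, h0 fun i => (u i).re]

theorem PosDef.transpose_eq {ι : Type*} {P : Matrix ι ι ℝ} (hP : P.PosDef) : Pᵀ = P := by
  simpa only [Matrix.conjTranspose_eq_transpose_of_trivial] using hP.isHermitian.eq

/-- A left eigenvector `y` of `T` gives `y T P y* = s · y P y*`. The left side has negative real
part and `y P y*` is real and positive, so `Re s < 0`. -/
theorem isHurwitz_of_negForm [DecidableEq ι] {T P : Matrix ι ι ℝ} (hP : P.PosDef)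
    (h : NegForm (T * P)) : IsHurwitz T := by
  intro s hs
  obtain ⟨y, hy, hys⟩ := mem_sigma_iff_exists_vecMul.mp hs
  have hu : star y ≠ 0 := star_ne_zero.mpr hy
  have key : star (star y) ⬝ᵥ complexify (T * P) *ᵥ star y
      = s * (star (star y) ⬝ᵥ complexify P *ᵥ star y) := by
    rw [star_star, complexify_mul, ← Matrix.mulVec_mulVec, Matrix.dotProduct_mulVec, hys,
      smul_dotProduct, smul_eq_mul]
  have h1 := re_eigenvalue_mul (PosDef.transpose_eq hP) key
  have h2 := h.re_star_dotProduct_neg hu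
  have h3 := PosDef.re_star_dotProduct_pos hP hu
  rw [h1] at h2
  by_contra! hc
  nlinarith [mul_nonneg hc h3.le]

end Lyapunov

/-! ### Solvability of the Lyapunov inequality by convex separation -/

section Stabilization

variable {ι κ : Type*} [Fintype ι] [Fintype κ]

/-- The form at `t b + v` is a quadratic in `t` that is nonnegative and has no constant term, so its
linear coefficient `2 (b ⬝ M v)` vanishes for every `b`. -/
theorem mulVec_eq_zero_of_form_eq_zero {M : Matrix ι ι ℝ} (hM : Mᵀ = M)
    (h0 : ∀ v, 0 ≤ v ⬝ᵥ M *ᵥ v) {v : ι → ℝ} (hv : v ⬝ᵥ M *ᵥ v = 0) : M *ᵥ v = 0 := by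
  classical
  have hsymm : ∀ a b, a ⬝ᵥ M *ᵥ b = b ⬝ᵥ M *ᵥ a := fun a b => by
    rw [Matrix.dotProduct_mulVec, ← Matrix.mulVec_transpose, hM, dotProduct_comm]
  have key : ∀ b, b ⬝ᵥ M *ᵥ v = 0 := by
    intro b
    have h1 : ∀ t : ℝ, 0 ≤ (b ⬝ᵥ M *ᵥ b) * (t * t) + (2 * (b ⬝ᵥ M *ᵥ v)) * t + 0 := by
      intro t
      have := h0 (t • b + v)
      rw [Matrix.mulVec_add, Matrix.mulVec_smul, add_dotProduct, dotProduct_add, dotProduct_add,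
        hv, smul_dotProduct, smul_dotProduct, dotProduct_smul, dotProduct_smul, hsymm v b] at this
      simp only [smul_eq_mul] at this
      linarith
    have h2 := discrim_le_zero h1
    rw [discrim] at h2
    nlinarith [sq_nonneg (b ⬝ᵥ M *ᵥ v)]
  ext i
  simpa using key (Pi.single i 1)

/-- A right inverse of `M` on its range, extended to the whole space, sends `M v` to a vector
differing from `v` by an element of `ker M`, which `N` also kills. -/
theorem exists_mul_eq_of_ker_le {M N : Matrix ι ι ℝ} (h : ∀ v, M *ᵥ v = 0 → N *ᵥ v = 0) :
    ∃ V : Matrix ι ι ℝ, N = V * M := by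
  classical
  let f := M.mulVecLin
  obtain ⟨g, hg⟩ := f.rangeRestrict.exists_rightInverse_of_surjective f.range_rangeRestrict
  obtain ⟨g', hg'⟩ := g.exists_extend
  refine ⟨N * LinearMap.toMatrix' g', ?_⟩
  apply Matrix.ext_of_mulVec_single
  intro i
  set v : ι → ℝ := Pi.single i 1
  rw [← Matrix.mulVec_mulVec, ← Matrix.mulVec_mulVec, LinearMap.toMatrix'_mulVec, ← sub_eq_zero,
    ← Matrix.mulVec_sub]
  apply h
  rw [Matrix.mulVec_sub, sub_eq_zero]
  have h1 : g' (M *ᵥ v) = g (f.rangeRestrict v) := LinearMap.congr_fun hg' (f.rangeRestrict v)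
  have h2 := congrArg Subtype.val (LinearMap.congr_fun hg (f.rangeRestrict v))
  rw [h1]
  exact h2.symm

theorem form_smul (M : Matrix ι ι ℝ) (c : ℝ) (v : ι → ℝ) :
    (c • v) ⬝ᵥ M *ᵥ (c • v) = c ^ 2 * (v ⬝ᵥ M *ᵥ v) := by
  rw [Matrix.mulVec_smul, smul_dotProduct, dotProduct_smul, smul_eq_mul, smul_eq_mul]; ring

theorem negForm_iff_forall_sphere {M : Matrix ι ι ℝ} :
    NegForm M ↔ ∀ v ∈ Metric.sphere (0 : ι → ℝ) 1, v ⬝ᵥ M *ᵥ v < 0 := by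
  constructor
  · intro h v hv
    exact h v (ne_zero_of_mem_unit_sphere ⟨v, hv⟩)
  · intro h v hv
    have hn : 0 < ‖v‖ := norm_pos_iff.mpr hv
    have h1 := h (‖v‖⁻¹ • v) (by simp [norm_smul, hn.ne'])
    rw [form_smul] at h1
    have : 0 < (‖v‖⁻¹) ^ 2 := by positivity
    by_contra! hc
    nlinarith [mul_nonneg this.le hc]

/-- By homogeneity only the unit sphere matters, and its compactness makes strict negativity stable
under perturbation. -/
theorem isOpen_setOf_negForm : IsOpen {M : Matrix ι ι ℝ | NegForm M} := by
  rw [isOpen_iff_mem_nhds]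
  intro M hM
  have hM' := negForm_iff_forall_sphere.mp hM
  have := (isCompact_sphere (0 : ι → ℝ) 1).eventually_forall_of_forall_eventually
    (x₀ := M) (P := fun M v => v ⬝ᵥ M *ᵥ v < 0) (fun v hv => by
      have hc : Continuous fun z : Matrix ι ι ℝ × (ι → ℝ) => z.2 ⬝ᵥ z.1 *ᵥ z.2 := by fun_prop
      exact hc.continuousAt.eventually_lt continuousAt_const (hM' v hv))
  filter_upwards [this] with N hN
  exact negForm_iff_forall_sphere.mpr hN

theorem convex_setOf_negForm : Convex ℝ {M : Matrix ι ι ℝ | NegForm M} := by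
  rw [convex_iff_forall_pos]
  intro M hM N hN a b ha hb _ v hv
  rw [Matrix.add_mulVec, dotProduct_add, Matrix.smul_mulVec, Matrix.smul_mulVec, dotProduct_smul,
    dotProduct_smul, smul_eq_mul, smul_eq_mul]
  nlinarith [mul_neg_of_pos_of_neg ha (hM v hv), mul_neg_of_pos_of_neg hb (hN v hv)]

theorem nonneg_of_forall_pos_add_mul {x y : ℝ} (h : ∀ ε : ℝ, 0 < ε → 0 ≤ x + ε * y) : 0 ≤ x := by
  have ht : Tendsto (fun ε : ℝ => x + ε * y) (𝓝[>] 0) (𝓝 (x + 0 * y)) :=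
    (Continuous.tendsto (by fun_prop) 0).mono_left nhdsWithin_le_nhds
  rw [zero_mul, add_zero] at ht
  exact ge_of_tendsto ht (eventually_mem_nhdsWithin.mono h)

/-- The matrix representing a linear functional on the space of square matrices. -/
theorem exists_matrix_of_functional [DecidableEq ι] (f : Matrix ι ι ℝ →L[ℝ] ℝ) :
    ∃ W : Matrix ι ι ℝ, ∀ a b, f (Matrix.vecMulVec a b) = a ⬝ᵥ W *ᵥ b := by
  refine ⟨Matrix.of fun i j => f (Matrix.single i j 1), fun a b => ?_⟩
  rw [Matrix.matrix_eq_sum_single (Matrix.vecMulVec a b), map_sum, dotProduct]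
  refine Finset.sum_congr rfl fun i _ => ?_
  rw [map_sum, mulVec, dotProduct, Finset.mul_sum]
  refine Finset.sum_congr rfl fun j _ => ?_
  have : Matrix.single i j (Matrix.vecMulVec a b i j) =
      (a i * b j) • Matrix.single i j (1 : ℝ) := by
    simp [Matrix.smul_single, Matrix.vecMulVec_apply]
  rw [this, map_smul, smul_eq_mul, Matrix.of_apply]
  ring

/-- A functional that separates the matrices with negative definite form from the cone
`{A P + B Y : P ≻ 0}` is given by a multiplier `W ⪰ 0`. -/
theorem exists_multiplier [DecidableEq ι] (A : Matrix ι ι ℝ) (B : Matrix ι κ ℝ)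
    (h : ∀ (P : Matrix ι ι ℝ) (Y : Matrix κ ι ℝ), P.PosDef → ¬ NegForm (A * P + B * Y)) :
    ∃ W : Matrix ι ι ℝ, Wᵀ = W ∧ W ≠ 0 ∧ (∀ v, 0 ≤ v ⬝ᵥ W *ᵥ v) ∧ W * B = 0 ∧
      ∀ v, 0 ≤ v ⬝ᵥ (W * A) *ᵥ v := by
  classical
  let t : Set (Matrix ι ι ℝ) :=
    {M | ∃ (P : Matrix ι ι ℝ) (Y : Matrix κ ι ℝ), P.PosDef ∧ M = A * P + B * Y}
  have ht : Convex ℝ t := by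
    rw [convex_iff_forall_pos]
    rintro _ ⟨P, Y, hP, rfl⟩ _ ⟨P', Y', hP', rfl⟩ a b ha hb _
    refine ⟨a • P + b • P', a • Y + b • Y', (hP.smul ha).add (hP'.smul hb), ?_⟩
    simp only [Matrix.mul_add, Matrix.mul_smul, smul_add]
    abel
  have hd : Disjoint {M : Matrix ι ι ℝ | NegForm M} t := by
    rw [Set.disjoint_left]
    rintro M hM ⟨P, Y, hP, rfl⟩
    exact h P Y hP hM
  obtain ⟨f, u, hs, ht'⟩ :=
    geometric_hahn_banach_open convex_setOf_negForm isOpen_setOf_negForm ht hd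
  have hcone : ∀ (P : Matrix ι ι ℝ) (Y : Matrix κ ι ℝ), P.PosDef → ∀ c : ℝ, 0 < c →
      u ≤ c * f (A * P + B * Y) := fun P Y hP c hc => by
    rw [← smul_eq_mul, ← map_smul]
    exact ht' _ ⟨c • P, c • Y, hP.smul hc, by simp [smul_add]⟩
  -- The second set is a cone: scaling its elements by `c → 0` bounds the separating level by `0`.
  have hu : u ≤ 0 := by
    have h1 := nonneg_of_forall_pos_add_mul (x := -u)
      (y := f (A * 1 + B * (0 : Matrix κ ι ℝ))) fun c hc => by
        linarith [hcone 1 0 Matrix.PosDef.one c hc]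
    linarith
  have hneg : ∀ M, NegForm M → f M < 0 := fun M hM => (hs M hM).trans_le hu
  -- Scaling by `c → ∞` instead shows that `f` is nonnegative on the cone.
  have hpos : ∀ (P : Matrix ι ι ℝ) (Y : Matrix κ ι ℝ), P.PosDef → 0 ≤ f (A * P + B * Y) := by
    intro P Y hP
    refine nonneg_of_forall_pos_add_mul (y := -u) fun c hc => ?_
    have h1 := mul_le_mul_of_nonneg_left (hcone P Y hP c⁻¹ (inv_pos.mpr hc)) hc.le
    rw [mul_inv_cancel_left₀ hc.ne'] at h1
    linarith
  obtain ⟨W, hW⟩ := exists_matrix_of_functional f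
  have hone : ∀ v : ι → ℝ, v ≠ 0 → 0 < v ⬝ᵥ v := fun v hv =>
    (Matrix.dotProduct_self_star_pos_iff (v := v)).mpr hv
  have hsymm : Wᵀ = W := by
    have hab : ∀ a b, a ⬝ᵥ W *ᵥ b = b ⬝ᵥ W *ᵥ a := by
      intro a b
      -- Adding any multiple of an antisymmetric matrix to `-1` leaves its quadratic form unchanged.
      -- So `f` stays negative along a whole line, and its slope is zero.
      have h1 : ∀ c : ℝ, f (-1) + c * (a ⬝ᵥ W *ᵥ b - b ⬝ᵥ W *ᵥ a) < 0 := by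
        intro c
        rw [← hW, ← hW, ← map_sub, ← smul_eq_mul, ← map_smul, ← map_add]
        refine hneg _ fun v hv => ?_
        have h2 : v ⬝ᵥ (-1 + c • (vecMulVec a b - vecMulVec b a)) *ᵥ v = - (v ⬝ᵥ v) := by
          simp only [Matrix.add_mulVec, Matrix.neg_mulVec, Matrix.one_mulVec, Matrix.smul_mulVec,
            Matrix.sub_mulVec, Matrix.vecMulVec_mulVec, dotProduct_add, dotProduct_neg,
            dotProduct_smul, dotProduct_sub, op_smul_eq_smul, smul_eq_mul]
          rw [dotProduct_comm a v, dotProduct_comm b v]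
          ring
        rw [h2]
        linarith [hone v hv]
      by_contra hne
      have h3 := h1 (-f (-1) / (a ⬝ᵥ W *ᵥ b - b ⬝ᵥ W *ᵥ a))
      rw [div_mul_cancel₀ _ (sub_ne_zero.mpr hne)] at h3
      linarith
    ext i j
    simpa using hab (Pi.single j 1) (Pi.single i 1)
  have hpsd : ∀ v, 0 ≤ v ⬝ᵥ W *ᵥ v := by
    intro v
    refine nonneg_of_forall_pos_add_mul (y := -f (-1)) fun ε hε => ?_
    have h1 := hneg (ε • (-1) - vecMulVec v v) fun x hx => by
      simp only [Matrix.sub_mulVec, Matrix.neg_mulVec, Matrix.one_mulVec, Matrix.smul_mulVec,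
        Matrix.vecMulVec_mulVec, dotProduct_neg, dotProduct_smul, dotProduct_sub,
        op_smul_eq_smul, smul_eq_mul]
      rw [dotProduct_comm v x]
      nlinarith [mul_pos hε (hone x hx), mul_self_nonneg (x ⬝ᵥ v)]
    rw [map_sub, map_smul, hW, smul_eq_mul] at h1
    linarith
  have hvv : ∀ v : ι → ℝ, ∀ ε : ℝ, 0 < ε → (vecMulVec v v + ε • (1 : Matrix ι ι ℝ)).PosDef := by
    intro v ε hε
    refine Matrix.PosDef.posSemidef_add ?_ (Matrix.PosDef.one.smul hε)
    simpa using Matrix.posSemidef_vecMulVec_self_star v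
  refine ⟨W, hsymm, ?_, hpsd, ?_, ?_⟩
  · rintro rfl
    have h1 : f = 0 := by
      ext M
      rw [Matrix.matrix_eq_sum_single M, map_sum]
      refine Finset.sum_eq_zero fun i _ => ?_
      rw [map_sum]
      refine Finset.sum_eq_zero fun j _ => ?_
      have : Matrix.single i j (M i j) = M i j • vecMulVec (Pi.single i 1) (Pi.single j 1) := by
        rw [← Matrix.single_eq_single_vecMulVec_single, Matrix.smul_single, smul_eq_mul, mul_one]
      rw [this, map_smul, hW]
      simp
    have h2 := hneg (-1) fun v hv => by
      simpa [Matrix.neg_mulVec] using hone v hv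
    simp [h1] at h2
  -- The matrix `Y` ranges over a linear space, so a lower bound on `f` there forces `f (B Y) = 0`.
  · have h1 : ∀ c b, (B *ᵥ c) ⬝ᵥ W *ᵥ b = 0 := by
      intro c b
      rw [← hW]
      have h2 : ∀ t : ℝ, 0 ≤ f A + t * f (vecMulVec (B *ᵥ c) b) := by
        intro t
        have := hpos 1 (t • vecMulVec c b) Matrix.PosDef.one
        rwa [Matrix.mul_one, Matrix.mul_smul, Matrix.mul_vecMulVec, map_add, map_smul,
          smul_eq_mul] at this
      by_contra hne
      have h3 := h2 ((-f A - 1) / f (vecMulVec (B *ᵥ c) b))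
      rw [div_mul_cancel₀ _ hne] at h3
      linarith
    rw [← Matrix.transpose_eq_zero, Matrix.transpose_mul, hsymm]
    ext i j
    have := h1 (Pi.single i 1) (Pi.single j 1)
    rw [dotProduct_comm, Matrix.dotProduct_mulVec, ← Matrix.mulVec_transpose,
      Matrix.mulVec_mulVec] at this
    simpa using this
  · intro v
    -- Test the cone with `P = v vᵀ + ε 1`, `Y = 0`, and let `ε → 0`.
    have h1 : 0 ≤ f (vecMulVec (A *ᵥ v) v) := by
      refine nonneg_of_forall_pos_add_mul (y := f A) fun ε hε => ?_
      have := hpos _ 0 (hvv v ε hε)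
      rwa [Matrix.mul_zero, add_zero, Matrix.mul_add, Matrix.mul_smul, Matrix.mul_one,
        Matrix.mul_vecMulVec, map_add, map_smul, smul_eq_mul] at this
    rwa [hW, dotProduct_comm, ← Matrix.vecMul_transpose, hsymm, ← Matrix.dotProduct_mulVec,
      Matrix.mulVec_mulVec] at h1

/-- If `(A, B)` satisfies the Popov-Belevitch-Hautus test for stabilizability, then the Lyapunov
inequality for the closed loop is solvable. -/
theorem exists_posDef_negForm [DecidableEq ι] (A : Matrix ι ι ℝ) (B : Matrix ι κ ℝ)
    (h : ∀ s : ℂ, 0 ≤ s.re → ∀ y : ι → ℂ, y ᵥ* complexify A = s • y →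
      y ᵥ* complexify B = 0 → y = 0) :
    ∃ (P : Matrix ι ι ℝ) (Y : Matrix κ ι ℝ), P.PosDef ∧ NegForm (A * P + B * Y) := by
  by_contra! hcon
  obtain ⟨W, hsymm, hW0, hpsd, hWB, hWA⟩ := exists_multiplier A B hcon
  -- If `W v = 0`, the nonnegative symmetric form of `W A + (W A)ᵀ` vanishes at `v`, so the matrix
  -- kills `v`; the transposed term `Aᵀ W v` is zero anyway.
  have hker : ∀ v, W *ᵥ v = 0 → (W * A) *ᵥ v = 0 := by
    intro v hv
    have hform : ∀ x, x ⬝ᵥ (W * A + (W * A)ᵀ) *ᵥ x = 2 * (x ⬝ᵥ (W * A) *ᵥ x) := fun x => by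
      rw [Matrix.add_mulVec, dotProduct_add, Matrix.mulVec_transpose,
        dotProduct_comm x (x ᵥ* _), ← Matrix.dotProduct_mulVec]
      ring
    have h0 : (W * A)ᵀ *ᵥ v = Aᵀ *ᵥ (W *ᵥ v) := by
      rw [Matrix.transpose_mul, hsymm, Matrix.mulVec_mulVec]
    have h1 : v ⬝ᵥ (W * A) *ᵥ v = 0 := by
      rw [Matrix.dotProduct_mulVec, ← Matrix.mulVec_transpose, h0, hv]; simp
    have h2 := mulVec_eq_zero_of_form_eq_zero (M := W * A + (W * A)ᵀ) (v := v)
      (by rw [Matrix.transpose_add, Matrix.transpose_transpose, add_comm])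
      (fun x => by rw [hform]; linarith [hWA x]) (by rw [hform, h1, mul_zero])
    rwa [Matrix.add_mulVec, h0, hv, Matrix.mulVec_zero, add_zero] at h2
  obtain ⟨V, hV⟩ := exists_mul_eq_of_ker_le hker
  -- From `W A = V W`, the row space of `W` is invariant under `y ↦ y A` and, being nonzero,
  -- contains a left eigenvector `y = x W` of `A`. Moreover `y B = x W B = 0`, so only `Re s ≥ 0`
  -- remains before the test contradicts `y ≠ 0`.
  let R : Submodule ℂ (ι → ℂ) := LinearMap.range (complexify W).vecMulLinear
  have hR : ∀ y ∈ R, (complexify A).vecMulLinear y ∈ R := by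
    rintro _ ⟨u, rfl⟩
    refine ⟨u ᵥ* complexify V, ?_⟩
    simp only [Matrix.vecMulLinear_apply, Matrix.vecMul_vecMul, ← complexify_mul, hV]
  have hRnt : Nontrivial R := by
    rw [Submodule.nontrivial_iff_ne_bot, Ne, LinearMap.range_eq_bot]
    intro h0
    apply hW0
    ext i j
    have := congrFun (LinearMap.congr_fun h0 (Pi.single i 1)) j
    simpa [complexify] using this
  obtain ⟨s, hs⟩ := Module.End.exists_eigenvalue ((complexify A).vecMulLinear.restrict hR)
  obtain ⟨⟨y, hyR⟩, hy⟩ := hs.exists_hasEigenvector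
  have hy0 : y ≠ 0 := fun h0 => hy.2 (by simp [h0])
  have hys : y ᵥ* complexify A = s • y := congrArg Subtype.val hy.apply_eq_smul
  obtain ⟨x, hx⟩ := hyR
  replace hx : x ᵥ* complexify W = y := hx
  refine hy0 (h s ?_ y hys ?_)
  · set u := star x
    have hux : star u = x := star_star x
    have key : star u ⬝ᵥ complexify (W * A) *ᵥ u = s * (star u ⬝ᵥ complexify W *ᵥ u) := by
      rw [hux, complexify_mul, Matrix.dotProduct_mulVec, ← Matrix.vecMul_vecMul, hx, hys,
        Matrix.dotProduct_mulVec, hx, smul_dotProduct, smul_eq_mul]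
    have h1 := re_eigenvalue_mul hsymm key
    rw [re_star_dotProduct_complexify_mulVec, re_star_dotProduct_complexify_mulVec] at h1
    have hre := hpsd fun i => (u i).re
    have him := hpsd fun i => (u i).im
    have hre' := hWA fun i => (u i).re
    have him' := hWA fun i => (u i).im
    -- In `Re (x W A x*) = Re s · x W x*` the left side is nonnegative. Thus `Re s < 0` would give
    -- `x W x* = 0`, hence `W x* = 0` and `y = x W = 0`.
    by_contra! hsneg
    have hz : (fun i => (u i).re) ⬝ᵥ W *ᵥ (fun i => (u i).re)
        + (fun i => (u i).im) ⬝ᵥ W *ᵥ (fun i => (u i).im) = 0 := by nlinarith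
    have z1 := mulVec_eq_zero_of_form_eq_zero hsymm hpsd
      (show (fun i => (u i).re) ⬝ᵥ W *ᵥ (fun i => (u i).re) = 0 by linarith)
    have z2 := mulVec_eq_zero_of_form_eq_zero hsymm hpsd
      (show (fun i => (u i).im) ⬝ᵥ W *ᵥ (fun i => (u i).im) = 0 by linarith)
    apply hy0
    rw [← hx, ← hux]
    ext j
    have e1 := congrFun z1 j
    have e2 := congrFun z2 j
    have hs' : ∀ i, W j i = W i j := fun i => congrFun (congrFun hsymm i) j
    simp only [mulVec, dotProduct, Pi.zero_apply, hs'] at e1 e2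
    apply Complex.ext
    · simpa [vecMul, dotProduct, complexify, mul_comm] using e1
    · simpa [vecMul, dotProduct, complexify, mul_comm] using e2
  · rw [← hx, Matrix.vecMul_vecMul, ← complexify_mul, hWB]
    simp [complexify]

end Stabilization

/-! ### Companion matrices and the internal model property -/

section Companion

theorem iterate_divX_coeff (p : Polynomial ℝ) (j k : ℕ) :
    (Polynomial.divX^[j] p).coeff k = p.coeff (k + j) := by
  induction j generalizing k with
  | zero => rfl
  | succ j ih => rw [Function.iterate_succ_apply', Polynomial.coeff_divX, ih]; congr 1; ring

theorem iterate_divX_eq (p : Polynomial ℝ) (j : ℕ) :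
    Polynomial.X * Polynomial.divX^[j + 1] p + Polynomial.C (p.coeff j) =
      Polynomial.divX^[j] p := by
  have := Polynomial.divX_mul_X_add (Polynomial.divX^[j] p)
  rwa [iterate_divX_coeff, zero_add, ← Function.iterate_succ_apply' Polynomial.divX,
    mul_comm] at this

theorem iterate_divX_natDegree {p : Polynomial ℝ} (hp : p.Monic) :
    Polynomial.divX^[p.natDegree] p = 1 := by
  ext k
  rw [iterate_divX_coeff, Polynomial.coeff_one]
  split_ifs with h
  · rw [h, zero_add]; exact hp
  · exact Polynomial.coeff_eq_zero_of_natDegree_lt (by omega)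

variable {k : ℕ}

theorem minpoly_monic (M : Matrix (Fin k) (Fin k) ℝ) : (minpoly ℝ M).Monic :=
  minpoly.monic (Matrix.isIntegral M)

theorem minCompanion_apply (M : Matrix (Fin k) (Fin k) ℝ) (i j : Fin (minDeg M)) :
    minCompanion M i j = (if (j : ℕ) = (i : ℕ) + 1 then 1 else 0)
      + (if (i : ℕ) + 1 = minDeg M then -(minpoly ℝ M).coeff j else 0) := by
  have := j.isLt
  rw [minCompanion, Matrix.of_apply]
  split_ifs <;> first | omega | simp

/-- The shift by one with `g 0 = 0` treats column `0`, which has no superdiagonal entry, like the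
others. The lemma serves both right intertwiners and left eigenvectors. -/
theorem sum_minCompanion_smul {E : Type*} [AddCommGroup E] [Module ℝ E]
    (M : Matrix (Fin k) (Fin k) ℝ) (g : ℕ → E) (hg : g 0 = 0) (j : Fin (minDeg M)) :
    ∑ i, minCompanion M i j • g (i + 1) = g j - (minpoly ℝ M).coeff j • g (minDeg M) := by
  have hj := j.isLt
  simp only [minCompanion_apply, add_smul, Finset.sum_add_distrib, ite_smul, one_smul, zero_smul,
    neg_smul, sub_eq_add_neg]
  congr 1
  · obtain ⟨j, hj'⟩ := j
    cases j with
    | zero => simp [hg]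
    | succ j =>
      rw [Finset.sum_eq_single ⟨j, by omega⟩]
      · simp
      · rintro i - hi
        rw [if_neg]
        rintro h
        exact hi (Fin.ext (by simp at h ⊢; omega))
      · simp
  · rw [Finset.sum_eq_single ⟨minDeg M - 1, by omega⟩]
    · have : minDeg M - 1 + 1 = minDeg M := by omega
      simp [this]
    · rintro i - hi
      rw [if_neg]
      rintro h
      exact hi (Fin.ext (by simp; omega))
    · simp

theorem sum_lastVec_smul {E : Type*} [AddCommGroup E] [Module ℝ E] (d : ℕ) (ω : ℝ) (g : ℕ → E)
    (hg : g 0 = 0) : ∑ i : Fin d, lastVec d ω i • g (i + 1) = ω • g d := by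
  cases d with
  | zero => simp [hg]
  | succ d =>
    rw [Finset.sum_eq_single (Fin.last d)]
    · simp [lastVec]
    · rintro i - hi
      have : ¬ ((i : ℕ) = d) := fun h => hi (Fin.ext h)
      simp [lastVec, this]
    · simp

/-- A vector annihilated by `p(T)` is the image of `(0, …, 0, ω)` under a matrix that intertwines
`T` and the companion matrix of `p`. -/
theorem exists_intertwine_minCompanion {ι : Type*} [Fintype ι] [DecidableEq ι]
    (M : Matrix (Fin k) (Fin k) ℝ) {ω : ℝ} (hω : ω ≠ 0) (T : Matrix ι ι ℝ) (v : ι → ℝ)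
    (hv : Polynomial.aeval T (minpoly ℝ M) *ᵥ v = 0) :
    ∃ N : Matrix ι (Fin (minDeg M)) ℝ,
      T * N = N * minCompanion M ∧ N *ᵥ lastVec (minDeg M) ω = v := by
  set p := minpoly ℝ M with hp
  -- Horner's scheme: `divX^[j] p` is the quotient of `p` by `X ^ j`. Column `j` of the intertwiner
  -- is `g (j + 1)`; the last one is `ω⁻¹ • v`, and `g 0 = 0` because `p(T) v = 0`.
  let g : ℕ → ι → ℝ := fun j => Polynomial.aeval T (Polynomial.divX^[j] p) *ᵥ (ω⁻¹ • v)
  have hg0 : g 0 = 0 := by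
    simp only [g, Function.iterate_zero, id_eq, Matrix.mulVec_smul, hv, smul_zero]
  have hgd : g (minDeg M) = ω⁻¹ • v := by
    simp only [g]
    rw [minDeg, hp, iterate_divX_natDegree (minpoly_monic M), map_one, Matrix.one_mulVec]
  have hstep : ∀ j, T *ᵥ g (j + 1) = g j - p.coeff j • g (minDeg M) := by
    intro j
    rw [hgd]
    simp only [g]
    rw [← iterate_divX_eq p j, map_add, map_mul, Polynomial.aeval_X, Polynomial.aeval_C,
      Matrix.add_mulVec, Algebra.algebraMap_eq_smul_one, Matrix.smul_mulVec, Matrix.one_mulVec,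
      ← Matrix.mulVec_mulVec]
    abel
  refine ⟨Matrix.of fun i j => g (j + 1) i, ?_, ?_⟩
  · ext a j
    have h1 := congrFun (hstep j) a
    rw [← sum_minCompanion_smul M g hg0 j, Finset.sum_apply] at h1
    rw [Matrix.mul_apply, Matrix.mul_apply]
    refine Eq.trans h1 (Finset.sum_congr rfl fun i _ => ?_)
    rw [Pi.smul_apply, smul_eq_mul, mul_comm, Matrix.of_apply]
  · have h1 := sum_lastVec_smul (minDeg M) ω g hg0
    rw [hgd, smul_smul, mul_inv_cancel₀ hω, one_smul] at h1
    rw [← h1]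
    ext a
    rw [Finset.sum_apply, mulVec, dotProduct]
    refine Finset.sum_congr rfl fun i _ => ?_
    rw [Pi.smul_apply, smul_eq_mul, mul_comm, Matrix.of_apply]

/-- The last component of a left eigenvector of the companion matrix is nonzero, and the
eigenvalue is a root of the minimal polynomial. -/
theorem left_eigenvector_minCompanion (M : Matrix (Fin k) (Fin k) ℝ) {ω : ℝ} (hω : ω ≠ 0)
    {s : ℂ} {v : Fin (minDeg M) → ℂ} (hv : v ᵥ* complexify (minCompanion M) = s • v) :
    (v = 0 ∨ Polynomial.aeval s (minpoly ℝ M) = 0) ∧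
      ((∑ i, lastVec (minDeg M) ω i • v i) = 0 → v = 0) := by
  set p := minpoly ℝ M with hp
  let g : ℕ → ℂ := fun j =>
    match j with
    | 0 => 0
    | j + 1 => if h : j < minDeg M then v ⟨j, h⟩ else 0
  have hgv : ∀ i : Fin (minDeg M), g (i + 1) = v i := fun i => by simp [g]
  have hstep : ∀ j, j < minDeg M → g j = s * g (j + 1) + p.coeff j • g (minDeg M) := by
    intro j hj
    have h1 := sum_minCompanion_smul M g rfl ⟨j, hj⟩
    have h2 := congrFun hv ⟨j, hj⟩
    rw [Pi.smul_apply, ← hgv, smul_eq_mul] at h2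
    rw [← sub_eq_iff_eq_add, ← h2]
    refine Eq.trans h1.symm (Finset.sum_congr rfl fun i _ => by
      rw [hgv, Complex.real_smul, mul_comm]
      rfl)
  -- Running the recursion down from the last component expresses every component through it. The
  -- padding value `g 0 = 0` then reads `p(s) · g (minDeg M) = 0`.
  have hpoly : ∀ m j, j + m = minDeg M →
      g j = Polynomial.aeval s (Polynomial.divX^[j] p) * g (minDeg M) := by
    intro m
    induction m with
    | zero =>
      intro j hj
      rw [add_zero] at hj
      rw [hj, minDeg, hp, iterate_divX_natDegree (minpoly_monic M), map_one, one_mul]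
    | succ m ih =>
      intro j hj
      rw [hstep j (by omega), ih (j + 1) (by omega), ← iterate_divX_eq p j, map_add, map_mul,
        Polynomial.aeval_X, Polynomial.aeval_C, Complex.real_smul, Complex.coe_algebraMap]
      ring
  have hzero : g (minDeg M) = 0 → v = 0 := by
    intro h0
    ext i
    rw [← hgv, hpoly (minDeg M - (i + 1)) (i + 1) (by omega), h0, mul_zero, Pi.zero_apply]
  constructor
  · by_cases h0 : g (minDeg M) = 0
    · exact Or.inl (hzero h0)
    · right
      have h1 := hpoly (minDeg M) 0 (by omega)
      exact (mul_eq_zero.mp h1.symm).resolve_right h0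
  · intro h
    apply hzero
    have h1 := sum_lastVec_smul (minDeg M) ω g rfl
    simp only [hgv] at h1
    rw [h] at h1
    exact (smul_eq_zero.mp h1.symm).resolve_left hω

/-- The internal model property of the companion form. -/
theorem eq_zero_of_minCompanion_mul (S : Matrix (Fin k) (Fin k) ℝ) {ω : ℝ} (hω : ω ≠ 0)
    (R : Matrix (Fin (minDeg S)) (Fin k) ℝ) (E : Fin k → ℝ)
    (h : R * S = minCompanion S * R + Matrix.vecMulVec (lastVec (minDeg S) ω) E) : E = 0 := by
  have hrow : ∀ i : Fin (minDeg S),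
      R i ᵥ* S = ∑ j, minCompanion S i j • R j + lastVec (minDeg S) ω i • E := by
    intro i
    ext b
    have := congrFun (congrFun h i) b
    simpa [Matrix.mul_apply, vecMul, dotProduct, Matrix.vecMulVec_apply] using this
  -- Degree zero means the minimal polynomial is `1`, so the identity matrix is zero and `E`
  -- vanishes trivially.
  rcases Nat.eq_zero_or_pos (minDeg S) with hd | hd
  · have h1 : minpoly ℝ S = 1 := (minpoly_monic S).natDegree_eq_zero.mp hd
    have h2 := minpoly.aeval ℝ S
    rw [h1, map_one] at h2
    rw [← Matrix.vecMul_one E, h2, Matrix.vecMul_zero]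
  let r : Fin k → ℝ := R ⟨0, hd⟩
  -- The superdiagonal rows make row `j` of `R` equal to `r S ^ j`. The last row then says `r p(S) =
  -- ω E`, and `p(S) = 0`.
  have hpow : ∀ j (hj : j < minDeg S), R ⟨j, hj⟩ = r ᵥ* S ^ j := by
    intro j
    induction j with
    | zero => intro hj; simp [r]
    | succ j ih =>
      intro hj
      rw [pow_succ, ← Matrix.vecMul_vecMul, ← ih (by omega), hrow]
      rw [Finset.sum_eq_single ⟨j + 1, hj⟩]
      · have : ¬ (j + 1 = minDeg S) := by omega
        simp [minCompanion, lastVec, this]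
      · rintro i - hi
        have h1 : ¬ (j + 1 = minDeg S) := by omega
        have h2 : ¬ ((i : ℕ) = j + 1) := fun h => hi (Fin.ext h)
        simp [minCompanion, h1, h2]
      · simp
  have hlast := hrow ⟨minDeg S - 1, by omega⟩
  have hd1 : minDeg S - 1 + 1 = minDeg S := by omega
  rw [hpow, Matrix.vecMul_vecMul, ← pow_succ, hd1] at hlast
  have hsum : ∑ j, minCompanion S ⟨minDeg S - 1, by omega⟩ j • R j
      = -∑ j ∈ Finset.range (minDeg S), (minpoly ℝ S).coeff j • r ᵥ* S ^ j := by
    rw [← Fin.sum_univ_eq_sum_range (fun j => (minpoly ℝ S).coeff j • r ᵥ* S ^ j),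
      ← Finset.sum_neg_distrib]
    refine Finset.sum_congr rfl fun j _ => ?_
    rw [← hpow j j.isLt]
    simp [minCompanion, hd1]
  have hlv : lastVec (minDeg S) ω ⟨minDeg S - 1, by omega⟩ = ω := by simp [lastVec, hd1]
  have hp : r ᵥ* Polynomial.aeval S (minpoly ℝ S) =
      ∑ j ∈ Finset.range (minDeg S), (minpoly ℝ S).coeff j • r ᵥ* S ^ j
        + r ᵥ* S ^ minDeg S := by
    rw [Polynomial.aeval_eq_sum_range, Finset.sum_range_succ, Matrix.vecMul_add,
      Polynomial.Monic.coeff_natDegree (minpoly_monic S), one_smul, ← minDeg]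
    simp only [Matrix.vecMul_sum, Matrix.vecMul_smul]
  rw [hsum, hlv] at hlast
  rw [minpoly.aeval, Matrix.vecMul_zero, hlast] at hp
  have : ω • E = 0 := by rw [hp]; abel
  exact (smul_eq_zero.mp this).resolve_left hω

end Companion

/-! ### Trajectories with right derivatives -/

section Trajectories

variable {ι κ : Type*} [Fintype ι] [Fintype κ] {I : Set ℝ}

theorem SolvesOn.congr {z v v' : ℝ → ι → ℝ} (h : SolvesOn I z v) (hv : ∀ t ∈ I, v t = v' t) :
    SolvesOn I z v' :=
  ⟨h.1, fun t ht => hv t ht ▸ h.2 t ht⟩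

theorem SolvesOn.mulVec {z v : ℝ → ι → ℝ} (h : SolvesOn I z v) (M : Matrix κ ι ℝ) :
    SolvesOn I (fun t => M *ᵥ z t) (fun t => M *ᵥ v t) := by
  let f : (ι → ℝ) →L[ℝ] (κ → ℝ) := LinearMap.toContinuousLinearMap M.mulVecLin
  exact ⟨f.continuous.comp_continuousOn h.1,
    fun t ht => f.hasFDerivAt.comp_hasDerivWithinAt t (h.2 t ht)⟩

theorem SolvesOn.add {z v z' v' : ℝ → ι → ℝ} (h : SolvesOn I z v) (h' : SolvesOn I z' v') :
    SolvesOn I (fun t => z t + z' t) (fun t => v t + v' t) :=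
  ⟨h.1.add h'.1, fun t ht => (h.2 t ht).add (h'.2 t ht)⟩

theorem SolvesOn.sub {z v z' v' : ℝ → ι → ℝ} (h : SolvesOn I z v) (h' : SolvesOn I z' v') :
    SolvesOn I (fun t => z t - z' t) (fun t => v t - v' t) :=
  ⟨h.1.sub h'.1, fun t ht => (h.2 t ht).sub (h'.2 t ht)⟩

theorem SolvesOn.sumElim {z v : ℝ → ι → ℝ} {z' v' : ℝ → κ → ℝ} (h : SolvesOn I z v)
    (h' : SolvesOn I z' v') :
    SolvesOn I (fun t => Sum.elim (z t) (z' t)) (fun t => Sum.elim (v t) (v' t)) := by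
  refine ⟨continuousOn_pi.mpr ?_, fun t ht => hasDerivWithinAt_pi.mpr ?_⟩
  · rintro (i | i)
    · exact continuousOn_pi.mp h.1 i
    · exact continuousOn_pi.mp h'.1 i
  · rintro (i | i)
    · exact hasDerivWithinAt_pi.mp (h.2 t ht) i
    · exact hasDerivWithinAt_pi.mp (h'.2 t ht) i

/-- The endpoint `τ` is excluded because the derivative condition there is empty; the sampling times
`k τ / N` with `k < N` all avoid it. -/
theorem SolvesOn.hasDerivWithinAt_Ici_of_Icc {z v : ℝ → ι → ℝ} {τ t : ℝ}
    (h : SolvesOn (Set.Icc 0 τ) z v) (ht : t ∈ Set.Ico 0 τ) :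
    HasDerivWithinAt z (v t) (Set.Ici t) t := by
  refine (h.2 t ⟨ht.1, ht.2.le⟩).mono_of_mem_nhdsWithin ?_
  refine inter_mem ?_ self_mem_nhdsWithin
  filter_upwards [self_mem_nhdsWithin, mem_nhdsWithin_of_mem_nhds (Iio_mem_nhds ht.2)] with x hx hx'
  exact ⟨ht.1.trans hx, le_of_lt hx'⟩

theorem SolvesOn.hasDerivWithinAt_Ici {z v : ℝ → ι → ℝ} {t : ℝ}
    (h : SolvesOn (Set.Ici 0) z v) (ht : 0 ≤ t) : HasDerivWithinAt z (v t) (Set.Ici t) t := by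
  have := h.2 t ht
  rwa [Set.inter_eq_right.mpr (Set.Ici_subset_Ici.mpr ht)] at this

theorem SolvesOn.eqOn_of_linear {z z' : ℝ → ι → ℝ} {τ : ℝ} (T : Matrix ι ι ℝ)
    (h : SolvesOn (Set.Icc 0 τ) z fun t => T *ᵥ z t)
    (h' : SolvesOn (Set.Icc 0 τ) z' fun t => T *ᵥ z' t) (h0 : z 0 = z' 0) :
    Set.EqOn z z' (Set.Icc 0 τ) := by
  let f : (ι → ℝ) →L[ℝ] (ι → ℝ) := LinearMap.toContinuousLinearMap T.mulVecLin
  exact ODE_solution_unique (v := fun _ => f) (fun _ => f.lipschitz) h.1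
    (fun t ht => h.hasDerivWithinAt_Ici_of_Icc ht) h'.1
    (fun t ht => h'.hasDerivWithinAt_Ici_of_Icc ht) h0

end Trajectories

/-! ### Exponential decay of Hurwitz systems -/

section Decay

variable {ι : Type*} [Fintype ι]

/-- Openness supplies quantitative slack: a coercivity constant for `P ≻ 0` when `N = 1`, a decay
rate when `N = P`. -/
theorem NegForm.exists_add_smul {M : Matrix ι ι ℝ} (hM : NegForm M) (N : Matrix ι ι ℝ) :
    ∃ ε : ℝ, 0 < ε ∧ NegForm (M + ε • N) := by
  have hc : Continuous fun ε : ℝ => M + ε • N := by fun_prop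
  have h0 : {M : Matrix ι ι ℝ | NegForm M} ∈ 𝓝 (M + (0 : ℝ) • N) :=
    isOpen_setOf_negForm.mem_nhds (by simpa using hM)
  have h1 : ∀ᶠ ε in 𝓝[>] (0 : ℝ), NegForm (M + ε • N) :=
    nhdsWithin_le_nhds (hc.continuousAt.eventually h0)
  obtain ⟨ε, h2, h3⟩ := (h1.and self_mem_nhdsWithin).exists
  exact ⟨ε, h3, h2⟩

theorem NegForm.nonpos {M : Matrix ι ι ℝ} (hM : NegForm M) (v : ι → ℝ) : v ⬝ᵥ M *ᵥ v ≤ 0 := by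
  by_cases hv : v = 0
  · simp [hv]
  · exact (hM v hv).le

theorem norm_sq_le_dotProduct (v : ι → ℝ) : ‖v‖ ^ 2 ≤ v ⬝ᵥ v := by
  have h0 : 0 ≤ v ⬝ᵥ v := Finset.sum_nonneg fun i _ => mul_self_nonneg (v i)
  have h1 : ‖v‖ ≤ √(v ⬝ᵥ v) := by
    rw [pi_norm_le_iff_of_nonneg (Real.sqrt_nonneg _)]
    intro i
    apply Real.le_sqrt_of_sq_le
    rw [Real.norm_eq_abs, sq_abs, sq]
    exact Finset.single_le_sum (f := fun i => v i * v i) (fun i _ => mul_self_nonneg (v i))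
      (Finset.mem_univ i)
  calc ‖v‖ ^ 2 ≤ √(v ⬝ᵥ v) ^ 2 := by gcongr
    _ = v ⬝ᵥ v := Real.sq_sqrt h0

theorem PosDef.exists_norm_sq_le [DecidableEq ι] {P : Matrix ι ι ℝ} (hP : P.PosDef) :
    ∃ c : ℝ, 0 < c ∧ ∀ v : ι → ℝ, c * ‖v‖ ^ 2 ≤ v ⬝ᵥ P *ᵥ v := by
  have hneg : NegForm (-P) := fun v hv => by
    have := hP.dotProduct_mulVec_pos hv
    simpa [Matrix.neg_mulVec] using this
  obtain ⟨c, hc, h⟩ := hneg.exists_add_smul 1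
  refine ⟨c, hc, fun v => ?_⟩
  have h1 := h.nonpos v
  rw [Matrix.add_mulVec, Matrix.neg_mulVec, Matrix.smul_mulVec, Matrix.one_mulVec, dotProduct_add,
    dotProduct_neg, dotProduct_smul, smul_eq_mul] at h1
  nlinarith [norm_sq_le_dotProduct v]

theorem form_le_norm_sq (M : Matrix ι ι ℝ) (v : ι → ℝ) :
    v ⬝ᵥ M *ᵥ v ≤ (∑ i, ∑ j, |M i j|) * ‖v‖ ^ 2 := by
  simp only [dotProduct, mulVec, Finset.mul_sum, Finset.sum_mul]
  refine Finset.sum_le_sum fun i _ => Finset.sum_le_sum fun j _ => ?_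
  calc v i * (M i j * v j) ≤ |v i * (M i j * v j)| := le_abs_self _
    _ = |M i j| * (‖v i‖ * ‖v j‖) := by
      rw [abs_mul, abs_mul, Real.norm_eq_abs, Real.norm_eq_abs]; ring
    _ ≤ |M i j| * (‖v‖ * ‖v‖) := by gcongr <;> exact norm_le_pi_norm v _
    _ = |M i j| * ‖v‖ ^ 2 := by ring

theorem form_transpose_mul (T P : Matrix ι ι ℝ) (v : ι → ℝ) :
    (T *ᵥ v) ⬝ᵥ P *ᵥ v = v ⬝ᵥ (Tᵀ * P) *ᵥ v := by
  rw [dotProduct_comm, ← Matrix.mulVec_mulVec, Matrix.mulVec_transpose, dotProduct_comm v,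
    ← Matrix.dotProduct_mulVec]

theorem hasDerivWithinAt_form {P : Matrix ι ι ℝ} (hP : Pᵀ = P) {z : ℝ → ι → ℝ} {z' : ι → ℝ}
    {s : Set ℝ} {t : ℝ} (h : HasDerivWithinAt z z' s t) :
    HasDerivWithinAt (fun t => z t ⬝ᵥ P *ᵥ z t) (2 * (z' ⬝ᵥ P *ᵥ z t)) s t := by
  have hf := (LinearMap.toContinuousLinearMap P.mulVecLin).hasFDerivAt.comp_hasDerivWithinAt t h
  have h1 : ∀ i, HasDerivWithinAt (fun t => z t i * (P *ᵥ z t) i)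
      (z' i * (P *ᵥ z t) i + z t i * (P *ᵥ z') i) s t := fun i =>
    (hasDerivWithinAt_pi.mp h i).mul (hasDerivWithinAt_pi.mp hf i)
  have h2 := HasDerivWithinAt.fun_sum fun i (_ : i ∈ Finset.univ) => h1 i
  refine HasDerivWithinAt.congr_deriv h2 ?_
  rw [Finset.sum_add_distrib]
  change z' ⬝ᵥ P *ᵥ z t + z t ⬝ᵥ P *ᵥ z' = _
  rw [Matrix.dotProduct_mulVec (z t), ← Matrix.mulVec_transpose, hP, dotProduct_comm (P *ᵥ z t)]
  ring

/-- Trajectories of a Hurwitz linear system decay exponentially. -/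
theorem IsHurwitz.exists_decay [DecidableEq ι] {T : Matrix ι ι ℝ} (hT : IsHurwitz T) :
    ∃ M lam : ℝ, 0 < M ∧ 0 < lam ∧ ∀ z : ℝ → ι → ℝ,
      SolvesOn (Set.Ici 0) z (fun t => T *ᵥ z t) →
      ∀ t, 0 ≤ t → ‖z t‖ ≤ M * Real.exp (-lam * t) * ‖z 0‖ := by
  -- An input matrix without columns turns the stabilization result into the converse Lyapunov
  -- theorem; the transpose matches `v ⬝ P v` as Lyapunov function.
  obtain ⟨P, Y, hP, hneg⟩ := exists_posDef_negForm Tᵀ (0 : Matrix ι (Fin 0) ℝ)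
    fun s hs y hy _ => by
      by_contra hy0
      have h1 := mem_sigma_iff_exists_vecMul.mpr ⟨y, hy0, hy⟩
      rw [mem_sigma_iff_isRoot_charpoly, Matrix.charpoly_transpose,
        ← mem_sigma_iff_isRoot_charpoly] at h1
      linarith [hT s h1]
  rw [Matrix.zero_mul, add_zero] at hneg
  obtain ⟨ε, hε, hnegε⟩ := hneg.exists_add_smul P
  obtain ⟨c, hc, hcP⟩ := PosDef.exists_norm_sq_le hP
  -- The summand `1` keeps `C` positive even when the index type is empty.
  set C : ℝ := ∑ i, ∑ j, |P i j| + 1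
  have hC : 0 < C := by positivity
  refine ⟨√(C / c), ε, by positivity, hε, fun z hz t ht => ?_⟩
  -- The form of `Tᵀ P + ε P` is nonpositive, so `exp (2 ε t) (z ⬝ P z)` has nonpositive right
  -- derivative.
  have key : Real.exp (2 * ε * t) * (z t ⬝ᵥ P *ᵥ z t) ≤ z 0 ⬝ᵥ P *ᵥ z 0 := by
    have hcont : ContinuousOn (fun t => Real.exp (2 * ε * t) * (z t ⬝ᵥ P *ᵥ z t))
        (Set.Icc 0 t) := by
      have hq : Continuous fun v : ι → ℝ => v ⬝ᵥ P *ᵥ v := by fun_prop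
      have hz' := hz.1.mono (Set.Icc_subset_Ici_self : Set.Icc 0 t ⊆ Set.Ici 0)
      exact (Continuous.continuousOn (by fun_prop)).mul (hq.comp_continuousOn hz')
    have hder : ∀ r ∈ Set.Ico 0 t,
        HasDerivWithinAt (fun t => Real.exp (2 * ε * t) * (z t ⬝ᵥ P *ᵥ z t))
          (Real.exp (2 * ε * r) * (2 * ε) * (z r ⬝ᵥ P *ᵥ z r)
            + Real.exp (2 * ε * r) * (2 * ((T *ᵥ z r) ⬝ᵥ P *ᵥ z r))) (Set.Ici r) r := by
      intro r hr
      have he : HasDerivAt (fun t => Real.exp (2 * ε * t)) (Real.exp (2 * ε * r) * (2 * ε)) r := by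
        simpa using ((hasDerivAt_id r).const_mul (2 * ε)).exp
      exact he.hasDerivWithinAt.mul
        (hasDerivWithinAt_form (PosDef.transpose_eq hP) (hz.hasDerivWithinAt_Ici hr.1))
    have := image_le_of_deriv_right_le_deriv_boundary hcont hder
      (B := fun _ => z 0 ⬝ᵥ P *ᵥ z 0) (B' := fun _ => 0) (by simp) continuousOn_const
      (fun _ _ => hasDerivWithinAt_const _ _ _) (fun r _ => by
        have h1 := hnegε.nonpos (z r)
        rw [Matrix.add_mulVec, Matrix.smul_mulVec, dotProduct_add, dotProduct_smul,
          ← form_transpose_mul, smul_eq_mul] at h1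
        have h2 := mul_nonpos_of_nonneg_of_nonpos (Real.exp_pos (2 * ε * r)).le h1
        linarith) (Set.right_mem_Icc.mpr ht)
    exact this
  have h1 : c * ‖z t‖ ^ 2 ≤ Real.exp (-ε * t) ^ 2 * (C * ‖z 0‖ ^ 2) := by
    have h2 : z 0 ⬝ᵥ P *ᵥ z 0 ≤ C * ‖z 0‖ ^ 2 := by
      have := form_le_norm_sq P (z 0)
      simp only [C]
      nlinarith [sq_nonneg ‖z 0‖]
    have h3 : Real.exp (-ε * t) ^ 2 * Real.exp (2 * ε * t) = 1 := by
      rw [← Real.exp_nat_mul, ← Real.exp_add]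
      simp only [Nat.cast_ofNat]
      rw [show 2 * (-ε * t) + 2 * ε * t = 0 by ring, Real.exp_zero]
    calc c * ‖z t‖ ^ 2 ≤ z t ⬝ᵥ P *ᵥ z t := hcP _
      _ = Real.exp (-ε * t) ^ 2 * (Real.exp (2 * ε * t) * (z t ⬝ᵥ P *ᵥ z t)) := by
        rw [← mul_assoc, h3, one_mul]
      _ ≤ Real.exp (-ε * t) ^ 2 * (C * ‖z 0‖ ^ 2) :=
        mul_le_mul_of_nonneg_left (key.trans h2) (sq_nonneg _)
  have h4 : ‖z t‖ ^ 2 ≤ (√(C / c) * Real.exp (-ε * t) * ‖z 0‖) ^ 2 := by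
    rw [mul_pow, mul_pow, Real.sq_sqrt (by positivity)]
    rw [← le_div_iff₀' hc] at h1
    refine h1.trans_eq ?_
    field_simp
  exact le_of_sq_le_sq h4 (by positivity)

theorem IsHurwitz.tendsto_zero [DecidableEq ι] {T : Matrix ι ι ℝ} (hT : IsHurwitz T)
    {z : ℝ → ι → ℝ} (hz : SolvesOn (Set.Ici 0) z fun t => T *ᵥ z t) : Tendsto z atTop (𝓝 0) := by
  obtain ⟨M, lam, -, hlam, h⟩ := hT.exists_decay
  have h1 : Tendsto (fun t => M * Real.exp (-lam * t) * ‖z 0‖) atTop (𝓝 (M * 0 * ‖z 0‖)) := by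
    refine ((Real.tendsto_exp_atBot.comp ?_).const_mul M).mul_const _
    exact tendsto_id.const_mul_atTop_of_neg (neg_lt_zero.mpr hlam)
  rw [mul_zero, zero_mul] at h1
  exact squeeze_zero_norm' (eventually_atTop.mpr ⟨0, fun t ht => h z hz t ht⟩) h1

end Decay

/-! ### The non-minimal realization and stabilizability of its extension -/

section Realization

variable {n m q r l μ : ℕ}

/-- The full matrix `col(Q_e, Q_r)` from the exosystem to the outputs. -/
def Plant.Q (pl : Plant n m q r l) : Matrix (Fin q ⊕ Fin r) (Fin l) ℝ :=
  Matrix.fromRows pl.Qe pl.Qr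

/-- The matrix `A - Π L C` of the error dynamics `x - Π ζ`. -/
def errorMatrix (pl : Plant n m q r l) (L : Matrix (Fin μ) (Fin q ⊕ Fin r) ℝ)
    (Pi : Matrix (Fin n) (Fin μ) ℝ) : Matrix (Fin n) (Fin n) ℝ :=
  pl.A - Pi * L * pl.C

/-- The matrix `P - Π L Q` through which the exosystem drives the error dynamics. -/
def errorInput (pl : Plant n m q r l) (L : Matrix (Fin μ) (Fin q ⊕ Fin r) ℝ)
    (Pi : Matrix (Fin n) (Fin μ) ℝ) : Matrix (Fin n) (Fin l) ℝ :=
  pl.P - Pi * L * pl.Q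

/-- The realization extended by the internal model. -/
def augMatrix (pl : Plant n m q r l) (S : Matrix (Fin l) (Fin l) ℝ) (F : Matrix (Fin μ) (Fin μ) ℝ)
    (L : Matrix (Fin μ) (Fin q ⊕ Fin r) ℝ) (H : Matrix (Fin q ⊕ Fin r) (Fin μ) ℝ)
    (Pi : Matrix (Fin n) (Fin μ) ℝ) (ωs : ℝ) :
    Matrix (Fin μ ⊕ Fin q × Fin (minDeg S)) (Fin μ ⊕ Fin q × Fin (minDeg S)) ℝ :=
  Matrix.fromBlocks (F + L * H) 0 (imGamma q S ωs * (pl.Ce * Pi)) (imPhi q S)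

/-- The input matrix of the realization extended by the internal model. -/
def augInput (q : ℕ) (S : Matrix (Fin l) (Fin l) ℝ) (G : Matrix (Fin μ) (Fin m) ℝ) :
    Matrix (Fin μ ⊕ Fin q × Fin (minDeg S)) (Fin m) ℝ :=
  Matrix.fromRows G 0

theorem exists_right_inverse_of_isControllable {A : Matrix (Fin n) (Fin n) ℝ}
    {B : Matrix (Fin n) (Fin m) ℝ} (h : IsControllable A B) :
    ∃ R : Matrix (Fin n × Fin m) (Fin n) ℝ, controllabilityMatrix A B * R = 1 :=
  exists_right_inverse_of_rank _ (by rw [Fintype.card_fin]; exact h)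

theorem IsControllable.eq_zero_of_left_eigenvector {A : Matrix (Fin n) (Fin n) ℝ}
    {B : Matrix (Fin n) (Fin m) ℝ} (h : IsControllable A B) {s : ℂ} {w : Fin n → ℂ}
    (hA : w ᵥ* complexify A = s • w) (hB : w ᵥ* complexify B = 0) : w = 0 := by
  obtain ⟨R, hR⟩ := exists_right_inverse_of_isControllable h
  have hR' : complexify (controllabilityMatrix A B) * complexify R = 1 := by
    rw [← complexify_mul, hR, complexify_one]
  apply eq_zero_of_vecMul_eq_zero hR'
  ext ⟨k, b⟩
  have h1 := vecMul_aeval hA (Polynomial.X ^ (k : ℕ))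
  have h2 : w ᵥ* complexify (A ^ (k : ℕ) * B) = 0 := by
    rw [map_pow, Polynomial.aeval_X] at h1
    rw [complexify_mul, ← Matrix.vecMul_vecMul, h1, Matrix.smul_vecMul, hB, smul_zero]
  exact congrFun h2 b

variable {pl : Plant n m q r l} {F : Matrix (Fin μ) (Fin μ) ℝ} {G : Matrix (Fin μ) (Fin m) ℝ}
  {L : Matrix (Fin μ) (Fin q ⊕ Fin r) ℝ} {H : Matrix (Fin q ⊕ Fin r) (Fin μ) ℝ}
  {Pi : Matrix (Fin n) (Fin μ) ℝ}

namespace IsCanonicalRealization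

/-- Since `A ^ k B = Π (F + L H) ^ k G`, the range of `Π` contains every column of the
controllability matrix. -/
theorem exists_right_inverse (hreal : IsCanonicalRealization pl F G L H Pi)
    (hctrb : IsControllable pl.A pl.B) : ∃ R : Matrix (Fin μ) (Fin n) ℝ, Pi * R = 1 := by
  obtain ⟨R, hR⟩ := exists_right_inverse_of_isControllable hctrb
  have hpow : ∀ k : ℕ, pl.A ^ k * pl.B = Pi * ((F + L * H) ^ k * G) := by
    intro k
    have := aeval_mul_eq_mul_aeval hreal.intertwine.symm (Polynomial.X ^ k)
    simp only [map_pow, Polynomial.aeval_X] at this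
    rw [← hreal.input, ← Matrix.mul_assoc, this, Matrix.mul_assoc]
  refine ⟨(Matrix.of fun i (kj : Fin n × Fin m) =>
    ((F + L * H) ^ (kj.1 : ℕ) * G) i kj.2) * R, ?_⟩
  rw [← Matrix.mul_assoc, ← hR]
  congr 1
  ext i ⟨k, j⟩
  exact (congrFun (congrFun (hpow k) i) j).symm

theorem errorMatrix_mul (hreal : IsCanonicalRealization pl F G L H Pi) :
    errorMatrix pl L Pi * Pi = Pi * F := by
  have h := hreal.intertwine
  rw [Matrix.mul_add, hreal.output] at h
  rw [errorMatrix, Matrix.sub_mul, ← h]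
  simp only [Matrix.mul_assoc]
  abel

theorem aeval_errorMatrix (hreal : IsCanonicalRealization pl F G L H Pi)
    (hctrb : IsControllable pl.A pl.B) :
    Polynomial.aeval (errorMatrix pl L Pi) (minpoly ℝ F) = 0 := by
  obtain ⟨R, hR⟩ := hreal.exists_right_inverse hctrb
  have h := aeval_mul_eq_mul_aeval hreal.errorMatrix_mul (minpoly ℝ F)
  rw [minpoly.aeval, Matrix.mul_zero] at h
  rw [← Matrix.mul_one (Polynomial.aeval _ _), ← hR, ← Matrix.mul_assoc, h, Matrix.zero_mul]

theorem isHurwitz_errorMatrix (hreal : IsCanonicalRealization pl F G L H Pi)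
    (hctrb : IsControllable pl.A pl.B) : IsHurwitz (errorMatrix pl L Pi) :=
  isHurwitz_of_aeval_minpoly hreal.hurwitz (hreal.aeval_errorMatrix hctrb)

end IsCanonicalRealization

theorem vecMul_imPhi_apply (S : Matrix (Fin l) (Fin l) ℝ) (v : Fin q × Fin (minDeg S) → ℂ)
    (a : Fin q) (j : Fin (minDeg S)) :
    (v ᵥ* complexify (imPhi q S)) (a, j) =
      ((fun i => v (a, i)) ᵥ* complexify (minCompanion S)) j := by
  simp only [vecMul, dotProduct, Fintype.sum_prod_type, imPhi, complexify, Matrix.map_apply,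
    Matrix.kroneckerMap_apply]
  rw [Finset.sum_eq_single a]
  · simp
  · intro b _ hb
    simp [hb]
  · simp

theorem imGamma_apply (S : Matrix (Fin l) (Fin l) ℝ) (ω : ℝ) (b a : Fin q)
    (i : Fin (minDeg S)) :
    imGamma q S ω (b, i) a = if b = a then lastVec (minDeg S) ω i else 0 := by
  simp [imGamma, Matrix.kroneckerMap_apply, Matrix.one_apply]

theorem vecMul_imGamma_apply (S : Matrix (Fin l) (Fin l) ℝ) (ω : ℝ)
    (v : Fin q × Fin (minDeg S) → ℂ) (a : Fin q) :
    (v ᵥ* complexify (imGamma q S ω)) a = ∑ i, lastVec (minDeg S) ω i • v (a, i) := by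
  simp only [vecMul, dotProduct, Fintype.sum_prod_type, complexify, Matrix.map_apply,
    imGamma_apply]
  rw [Finset.sum_eq_single a]
  · simp [mul_comm]
  · intro b _ hb
    simp [hb]
  · simp

theorem left_eigenvector_imPhi (S : Matrix (Fin l) (Fin l) ℝ) {ω : ℝ} (hω : ω ≠ 0) {s : ℂ}
    {v : Fin q × Fin (minDeg S) → ℂ} (hv : v ᵥ* complexify (imPhi q S) = s • v) :
    (v = 0 ∨ s ∈ sigma S) ∧ (v ᵥ* complexify (imGamma q S ω) = 0 → v = 0) := by
  have hblock : ∀ a, (fun i => v (a, i)) ᵥ* complexify (minCompanion S)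
      = s • fun i => v (a, i) := by
    intro a
    ext j
    rw [← vecMul_imPhi_apply, hv]
    rfl
  constructor
  · by_cases hs : Polynomial.aeval s (minpoly ℝ S) = 0
    · exact Or.inr (mem_sigma_of_aeval_minpoly hs)
    · left
      ext ⟨a, i⟩
      exact congrFun ((left_eigenvector_minCompanion S hω (hblock a)).1.resolve_right hs) i
  · intro h
    ext ⟨a, i⟩
    have h1 := congrFun h a
    rw [vecMul_imGamma_apply] at h1
    exact congrFun ((left_eigenvector_minCompanion S hω (hblock a)).2 h1) i

theorem NonResonance.eq_zero {S : Matrix (Fin l) (Fin l) ℝ} (hres : NonResonance pl S) {s : ℂ}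
    (hs : s ∈ sigma S) {w : Fin n → ℂ} {c : Fin q → ℂ}
    (hA : w ᵥ* complexify pl.A + c ᵥ* complexify pl.Ce = s • w)
    (hB : w ᵥ* complexify pl.B = 0) : w = 0 ∧ c = 0 := by
  obtain ⟨R, hR⟩ := exists_right_inverse_of_rank _
    ((hres s hs).trans (by simp : n + q = Fintype.card (Fin n ⊕ Fin q)))
  have h0 : Sum.elim w c = 0 := by
    apply eq_zero_of_vecMul_eq_zero hR
    rw [Matrix.vecMul_fromBlocks, Sum.elim_comp_inl, Sum.elim_comp_inr, Matrix.vecMul_sub,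
      Matrix.vecMul_smul, Matrix.vecMul_one, Matrix.vecMul_zero, hB, add_zero, ← hA]
    ext (i | i)
    · simp only [Sum.elim_inl, Pi.add_apply, Pi.sub_apply, Pi.zero_apply]
      ring
    · rfl
  exact ⟨funext fun i => congrFun h0 (Sum.inl i), funext fun i => congrFun h0 (Sum.inr i)⟩

theorem complexify_add {ι κ : Type*} (M N : Matrix ι κ ℝ) :
    complexify (M + N) = complexify M + complexify N :=
  Matrix.map_add _ (map_add _) M N

/-- The Popov-Belevitch-Hautus test for the realization extended by the internal model. -/
theorem augMatrix_stabilizable (hctrb : IsControllable pl.A pl.B)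
    {S : Matrix (Fin l) (Fin l) ℝ} (hres : NonResonance pl S)
    (hreal : IsCanonicalRealization pl F G L H Pi) {ωs : ℝ} (hωs : ωs ≠ 0)
    {s : ℂ} (hs : 0 ≤ s.re) {y : Fin μ ⊕ Fin q × Fin (minDeg S) → ℂ}
    (hA : y ᵥ* complexify (augMatrix pl S F L H Pi ωs) = s • y)
    (hB : y ᵥ* complexify (augInput q S G) = 0) : y = 0 := by
  obtain ⟨v₁, hv₁⟩ : ∃ v, v = y ∘ Sum.inl := ⟨_, rfl⟩
  obtain ⟨v₂, hv₂⟩ : ∃ v, v = y ∘ Sum.inr := ⟨_, rfl⟩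
  obtain ⟨c, hc⟩ : ∃ c, c = v₂ ᵥ* complexify (imGamma q S ωs) := ⟨_, rfl⟩
  rw [augMatrix, complexify, Matrix.fromBlocks_map, Matrix.vecMul_fromBlocks, ← hv₁, ← hv₂] at hA
  have h1 : v₁ ᵥ* complexify (F + L * H) + c ᵥ* complexify (pl.Ce * Pi) = s • v₁ := by
    rw [hc, Matrix.vecMul_vecMul, ← complexify_mul]
    ext i
    rw [hv₁] at hA ⊢
    exact congrFun hA (Sum.inl i)
  have h2 : v₂ ᵥ* complexify (imPhi q S) = s • v₂ := by
    rw [Matrix.map_zero _ (map_zero _), Matrix.vecMul_zero, zero_add] at hA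
    ext i
    rw [hv₂] at hA ⊢
    exact congrFun hA (Sum.inr i)
  have h3 : v₁ ᵥ* complexify G = 0 := by
    rwa [augInput, complexify, Matrix.fromRows_map, Matrix.vecMul_fromRows, ← hv₁,
      Matrix.map_zero _ (map_zero _), Matrix.vecMul_zero, add_zero] at hB
  obtain ⟨E, hE⟩ : ∃ E, E = complexify (errorMatrix pl L Pi) := ⟨_, rfl⟩
  have hu : IsUnit (algebraMap ℂ _ s - E) := by
    by_contra hu
    have : s ∈ sigma (errorMatrix pl L Pi) := by rwa [hE] at hu
    linarith [hreal.isHurwitz_errorMatrix hctrb s this]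
  obtain ⟨V, hV⟩ := hu.exists_left_inv
  -- The aim is `v₁ = w Π` and `w A + c C_e = s w`. Together they force `w (s - E) = c C_e + v₁ L
  -- C`, which is solvable because `E` is Hurwitz and `Re s ≥ 0`.
  obtain ⟨w, hw⟩ : ∃ w, w = (c ᵥ* complexify pl.Ce + v₁ ᵥ* complexify (L * pl.C)) ᵥ* V :=
    ⟨_, rfl⟩
  have hwE : w ᵥ* E = s • w - (c ᵥ* complexify pl.Ce + v₁ ᵥ* complexify (L * pl.C)) := by
    have : w ᵥ* (algebraMap ℂ _ s - E) =
        c ᵥ* complexify pl.Ce + v₁ ᵥ* complexify (L * pl.C) := by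
      rw [hw, Matrix.vecMul_vecMul, hV, Matrix.vecMul_one]
    rw [Matrix.vecMul_sub, Algebra.algebraMap_eq_smul_one, Matrix.vecMul_smul,
      Matrix.vecMul_one] at this
    rw [← this]; abel
  -- The difference `v₁ - w Π`, if nonzero, would be a left eigenvector of the Hurwitz matrix `F` at
  -- `s`.
  have hwPi : v₁ = w ᵥ* complexify Pi := by
    rw [← sub_eq_zero]
    by_contra hne
    have hF : (v₁ - w ᵥ* complexify Pi) ᵥ* complexify F = s • (v₁ - w ᵥ* complexify Pi) := by
      have e1 : w ᵥ* complexify Pi ᵥ* complexify F = w ᵥ* E ᵥ* complexify Pi := by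
        rw [Matrix.vecMul_vecMul, Matrix.vecMul_vecMul, hE, ← complexify_mul, ← complexify_mul,
          hreal.errorMatrix_mul]
      have e2 : v₁ ᵥ* complexify F = s • v₁ -
          (c ᵥ* complexify pl.Ce + v₁ ᵥ* complexify (L * pl.C)) ᵥ* complexify Pi := by
        rw [← h1, complexify_add, Matrix.vecMul_add, hreal.output, Matrix.add_vecMul,
          Matrix.vecMul_vecMul, Matrix.vecMul_vecMul, ← complexify_mul, ← complexify_mul,
          Matrix.mul_assoc]
        abel
      rw [Matrix.sub_vecMul, e1, e2, hwE, Matrix.sub_vecMul, Matrix.smul_vecMul, smul_sub]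
      abel
    linarith [hreal.hurwitz s (mem_sigma_iff_exists_vecMul.mpr ⟨_, hne, hF⟩)]
  have hwA : w ᵥ* complexify pl.A + c ᵥ* complexify pl.Ce = s • w := by
    have e1 : w ᵥ* complexify pl.A = w ᵥ* E + v₁ ᵥ* complexify (L * pl.C) := by
      rw [hwPi, Matrix.vecMul_vecMul, ← complexify_mul, ← Matrix.vecMul_add, hE,
        ← complexify_add, errorMatrix, Matrix.mul_assoc, sub_add_cancel]
    rw [e1, hwE]; abel
  have hwB : w ᵥ* complexify pl.B = 0 := by
    rw [← hreal.input, complexify_mul, ← Matrix.vecMul_vecMul, ← hwPi, h3]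
  have hfin : w = 0 ∧ v₂ = 0 := by
    obtain ⟨h4, h5⟩ := left_eigenvector_imPhi S hωs h2
    -- Either the internal model component vanishes and controllability applies, or `s ∈ σ(S)` and
    -- non-resonance gives `w = 0`, `c = 0`; then `v₂ Γ = 0` forces `v₂ = 0`.
    rcases h4 with h4 | h4
    · have hc0 : c = 0 := by rw [hc, h4, Matrix.zero_vecMul]
      rw [hc0, Matrix.zero_vecMul, add_zero] at hwA
      exact ⟨hctrb.eq_zero_of_left_eigenvector hwA hwB, h4⟩
    · obtain ⟨h6, h7⟩ := hres.eq_zero h4 hwA hwB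
      exact ⟨h6, h5 (hc.symm.trans h7)⟩
  rw [hfin.1, Matrix.zero_vecMul] at hwPi
  ext (i | i)
  · exact congrFun (hv₁ ▸ hwPi) i
  · exact congrFun (hv₂ ▸ hfin.2) i

end Realization

/-! ### The equation satisfied by the sampled data -/

section Data

variable {n m q r l μ : ℕ}

/-- The initial value problem of a linear system annihilated by the product of two coprime minimal
polynomials is solved through the corresponding companion systems. -/
theorem exists_intertwine_fromBlocks {ι : Type*} [Fintype ι] [DecidableEq ι] {k k' : ℕ}
    {M : Matrix (Fin k) (Fin k) ℝ} {M' : Matrix (Fin k') (Fin k') ℝ}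
    (hcop : IsCoprime (minpoly ℝ M) (minpoly ℝ M')) {ω ω' : ℝ} (hω : ω ≠ 0) (hω' : ω' ≠ 0)
    (T : Matrix ι ι ℝ) (v : ι → ℝ)
    (hv : Polynomial.aeval T (minpoly ℝ M * minpoly ℝ M') *ᵥ v = 0) :
    ∃ N : Matrix ι (Fin (minDeg M) ⊕ Fin (minDeg M')) ℝ,
      T * N = N * Matrix.fromBlocks (minCompanion M) 0 0 (minCompanion M') ∧
      N *ᵥ Sum.elim (lastVec (minDeg M) ω) (lastVec (minDeg M') ω') = v := by
  obtain ⟨a, b, hab⟩ := hcop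
  -- The Bézout identity splits `v` into `(b p')(T) v`, killed by `p(T)`, and `(a p)(T) v`, killed
  -- by `p'(T)`.
  obtain ⟨N, hN, hNv⟩ := exists_intertwine_minCompanion M hω T
    (Polynomial.aeval T (b * minpoly ℝ M') *ᵥ v) (by
      rw [Matrix.mulVec_mulVec, ← map_mul, show minpoly ℝ M * (b * minpoly ℝ M') =
        b * (minpoly ℝ M * minpoly ℝ M') by ring, map_mul, ← Matrix.mulVec_mulVec, hv,
        Matrix.mulVec_zero])
  obtain ⟨N', hN', hNv'⟩ := exists_intertwine_minCompanion M' hω' T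
    (Polynomial.aeval T (a * minpoly ℝ M) *ᵥ v) (by
      rw [Matrix.mulVec_mulVec, ← map_mul, show minpoly ℝ M' * (a * minpoly ℝ M) =
        a * (minpoly ℝ M * minpoly ℝ M') by ring, map_mul, ← Matrix.mulVec_mulVec, hv,
        Matrix.mulVec_zero])
  refine ⟨Matrix.fromCols N N', ?_, ?_⟩
  · rw [Matrix.mul_fromCols, Matrix.fromCols_mul_fromBlocks, hN, hN']
    simp
  · rw [Matrix.fromCols_mulVec_sumElim, hNv, hNv', ← Matrix.add_mulVec, ← map_add,
      add_comm (b * _), hab, map_one, Matrix.one_mulVec]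

/-- As `p(D) = 0`, `p(T)` maps everything into the first block. That subspace is invariant and `T`
acts on it as `A`, which `p'` annihilates. -/
theorem aeval_mul_fromBlocks_mulVec {ι κ : Type*} [Fintype ι] [Fintype κ] [DecidableEq ι]
    [DecidableEq κ] {A : Matrix ι ι ℝ} {D : Matrix κ κ ℝ} {p p' : Polynomial ℝ}
    (hp : Polynomial.aeval D p = 0) (hp' : Polynomial.aeval A p' = 0) (B : Matrix ι κ ℝ)
    (v : ι ⊕ κ → ℝ) : Polynomial.aeval (Matrix.fromBlocks A B 0 D) (p * p') *ᵥ v = 0 := by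
  set T := Matrix.fromBlocks A B 0 D
  have h1 : T * (Matrix.fromRows 1 0 : Matrix (ι ⊕ κ) ι ℝ) =
      (Matrix.fromRows 1 0 : Matrix (ι ⊕ κ) ι ℝ) * A := by
    simp [T, Matrix.fromBlocks_mul_fromRows, Matrix.fromRows_mul]
  have h2 : D * (Matrix.fromCols 0 1 : Matrix κ (ι ⊕ κ) ℝ) =
      (Matrix.fromCols 0 1 : Matrix κ (ι ⊕ κ) ℝ) * T := by
    simp [T, Matrix.fromCols_mul_fromBlocks, Matrix.mul_fromCols]
  have h3 := aeval_mul_eq_mul_aeval h1 p'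
  have h4 := aeval_mul_eq_mul_aeval h2 p
  rw [hp', Matrix.mul_zero] at h3
  rw [hp, Matrix.zero_mul] at h4
  obtain ⟨w, hw⟩ : ∃ w, w = Polynomial.aeval T p *ᵥ v := ⟨_, rfl⟩
  have h5 : w ∘ Sum.inr = 0 := by
    have := congrArg (· *ᵥ v) h4
    simpa [← Matrix.mulVec_mulVec, ← hw, Matrix.fromCols_mulVec] using this.symm
  have h6 : w = (Matrix.fromRows 1 0 : Matrix (ι ⊕ κ) ι ℝ) *ᵥ (w ∘ Sum.inl) := by
    ext (i | i)
    · simp [Matrix.fromRows_mulVec]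
    · simpa [Matrix.fromRows_mulVec] using congrFun h5 i
  rw [mul_comm, map_mul, ← Matrix.mulVec_mulVec, ← hw, h6, Matrix.mulVec_mulVec, h3,
    Matrix.zero_mulVec]

theorem toCols_mulVec_add (L : Matrix (Fin μ) (Fin q ⊕ Fin r) ℝ) (e : Fin q → ℝ)
    (y : Fin r → ℝ) : L.toCols₁ *ᵥ e + L.toCols₂ *ᵥ y = L *ᵥ Sum.elim e y := by
  rw [← Matrix.fromCols_mulVec_sumElim, Matrix.fromCols_toCols]

theorem Plant.sumElim_regOut_resOut (pl : Plant n m q r l) (x : Fin n → ℝ) (w : Fin l → ℝ) :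
    Sum.elim (pl.regOut x w) (pl.resOut x w) = pl.C *ᵥ x + pl.Q *ᵥ w := by
  rw [Plant.C, Plant.Q, Matrix.fromRows_mulVec, Matrix.fromRows_mulVec]
  ext (i | i) <;> rfl

variable {pl : Plant n m q r l} {S : Matrix (Fin l) (Fin l) ℝ}
  {F : Matrix (Fin μ) (Fin μ) ℝ} {G : Matrix (Fin μ) (Fin m) ℝ}
  {L : Matrix (Fin μ) (Fin q ⊕ Fin r) ℝ} {H : Matrix (Fin q ⊕ Fin r) (Fin μ) ℝ}
  {Pi : Matrix (Fin n) (Fin μ) ℝ}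

/-- The error `x - Π ζ` between the plant and its non-minimal realization is autonomous up to the
exogenous input. -/
theorem error_dynamics (hreal : IsCanonicalRealization pl F G L H Pi) (x : Fin n → ℝ)
    (ζ : Fin μ → ℝ) (u : Fin m → ℝ) (w : Fin l → ℝ) :
    (pl.A *ᵥ x + pl.B *ᵥ u + pl.P *ᵥ w)
        - Pi *ᵥ (F *ᵥ ζ + G *ᵥ u + L *ᵥ (pl.C *ᵥ x + pl.Q *ᵥ w)) =
      errorMatrix pl L Pi *ᵥ (x - Pi *ᵥ ζ) + errorInput pl L Pi *ᵥ w := by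
  have h1 : Pi *ᵥ (F *ᵥ ζ) = errorMatrix pl L Pi *ᵥ (Pi *ᵥ ζ) := by
    rw [Matrix.mulVec_mulVec, Matrix.mulVec_mulVec, hreal.errorMatrix_mul]
  rw [Matrix.mulVec_add, Matrix.mulVec_add, h1, Matrix.mulVec_sub, ← hreal.input,
    errorMatrix, errorInput]
  simp only [Matrix.sub_mulVec, Matrix.mulVec_add, ← Matrix.mulVec_mulVec]
  abel

/-- In an experiment, the error `x - Π ζ` and the exosystem state are linear in the state of the
auxiliary system. -/
theorem exists_error_eq_mulVec (hctrb : IsControllable pl.A pl.B) (hS : IsNeutrallyStable S)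
    (hreal : IsCanonicalRealization pl F G L H Pi) {τ ωs ωf : ℝ}
    (hωs : ωs ≠ 0) (hωf : ωf ≠ 0)
    {χ : ℝ → Fin (minDeg S) ⊕ Fin (minDeg F) → ℝ} (hχ : IsAuxState S F ωs ωf τ χ)
    {ε : ℝ → Fin n → ℝ} {w : ℝ → Fin l → ℝ}
    (hε : SolvesOn (Set.Icc 0 τ) ε
      fun t => errorMatrix pl L Pi *ᵥ ε t + errorInput pl L Pi *ᵥ w t)
    (hw : SolvesOn (Set.Icc 0 τ) w fun t => S *ᵥ w t) :
    ∃ N : Matrix (Fin n ⊕ Fin l) (Fin (minDeg S) ⊕ Fin (minDeg F)) ℝ,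
      ∀ t ∈ Set.Icc 0 τ, Sum.elim (ε t) (w t) = N *ᵥ χ t := by
  set T := Matrix.fromBlocks (errorMatrix pl L Pi) (errorInput pl L Pi) 0 S
  obtain ⟨N, hN, hN0⟩ := exists_intertwine_fromBlocks (isCoprime_minpoly hS hreal.hurwitz)
    hωs hωf T (Sum.elim (ε 0) (w 0))
    (aeval_mul_fromBlocks_mulVec (minpoly.aeval ℝ S) (hreal.aeval_errorMatrix hctrb) _ _)
  refine ⟨N, SolvesOn.eqOn_of_linear T ((hε.sumElim hw).congr fun t _ => ?_)
    ((hχ.2.mulVec N).congr fun t _ => ?_) ?_⟩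
  · rw [Matrix.fromBlocks_mulVec, Sum.elim_comp_inl, Sum.elim_comp_inr, Matrix.zero_mulVec,
      zero_add]
  · rw [Matrix.mulVec_mulVec, Matrix.mulVec_mulVec, hN]
  · rw [hχ.1, hN0]

/-- The sampled data satisfy the equation of the realization extended by the internal model, up to
a term that is linear in the samples of the auxiliary system. -/
theorem exists_batchDeriv_eq {N : ℕ} (hctrb : IsControllable pl.A pl.B)
    (hS : IsNeutrallyStable S) {τ : ℝ} (hτ : 0 < τ) {u : ℝ → Fin m → ℝ} {e : ℝ → Fin q → ℝ}
    {yr : ℝ → Fin r → ℝ} (hdata : IsDataset pl S τ u e yr)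
    (hreal : IsCanonicalRealization pl F G L H Pi)
    {ωs ωf : ℝ} (hωs : ωs ≠ 0) (hωf : ωf ≠ 0)
    {ζ : ℝ → Fin μ → ℝ} (hζ : IsFilterState F G L τ u e yr ζ)
    {η : ℝ → Fin q × Fin (minDeg S) → ℝ} (hη : IsInternalModelState S ωs τ e η)
    {χ : ℝ → Fin (minDeg S) ⊕ Fin (minDeg F) → ℝ} (hχ : IsAuxState S F ωs ωf τ χ) :
    ∃ D : Matrix (Fin μ ⊕ Fin q × Fin (minDeg S)) (Fin (minDeg S) ⊕ Fin (minDeg F)) ℝ,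
      Matrix.fromRows (batchDeriv N τ ζ) (batchDeriv N τ η) =
        augMatrix pl S F L H Pi ωs * Matrix.fromRows (batch N τ ζ) (batch N τ η)
          + augInput q S G * batch N τ u + D * batch N τ χ := by
  obtain ⟨w, x, hw, hx, he, hyr⟩ := hdata
  have hy : ∀ t ∈ Set.Icc 0 τ, Sum.elim (e t) (yr t) = pl.C *ᵥ x t + pl.Q *ᵥ w t := by
    intro t ht
    rw [he t ht, hyr t ht, pl.sumElim_regOut_resOut]
  have hζ' : SolvesOn (Set.Icc 0 τ) ζ
      fun t => F *ᵥ ζ t + G *ᵥ u t + L *ᵥ (pl.C *ᵥ x t + pl.Q *ᵥ w t) :=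
    hζ.2.congr fun t ht => by rw [add_assoc, toCols_mulVec_add, hy t ht]
  have hε : SolvesOn (Set.Icc 0 τ) (fun t => x t - Pi *ᵥ ζ t)
      fun t => errorMatrix pl L Pi *ᵥ (x t - Pi *ᵥ ζ t) + errorInput pl L Pi *ᵥ w t :=
    (hx.sub (hζ'.mulVec Pi)).congr fun t _ => error_dynamics hreal _ _ _ _
  obtain ⟨V, hV⟩ := exists_error_eq_mulVec hctrb hS hreal hωs hωf hχ hε hw
  -- Substituting `x = Π ζ + ε` leaves the unmeasured `ε` and `w`, both linear in `χ`.
  have hC : ∀ t ∈ Set.Icc 0 τ, pl.C *ᵥ x t + pl.Q *ᵥ w t =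
      H *ᵥ ζ t + (Matrix.fromCols pl.C pl.Q * V) *ᵥ χ t := by
    intro t ht
    rw [← Matrix.mulVec_mulVec, ← hV t ht, Matrix.fromCols_mulVec_sumElim, hreal.output,
      Matrix.mulVec_sub, Matrix.mulVec_mulVec]
    abel
  have hCe : ∀ t ∈ Set.Icc 0 τ, e t =
      (pl.Ce * Pi) *ᵥ ζ t + (Matrix.fromCols pl.Ce pl.Qe * V) *ᵥ χ t := by
    intro t ht
    rw [he t ht, ← Matrix.mulVec_mulVec (χ t), ← hV t ht, Matrix.fromCols_mulVec_sumElim,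
      Matrix.mulVec_sub, Matrix.mulVec_mulVec, Plant.regOut]
    abel
  set D := Matrix.fromRows (L * (Matrix.fromCols pl.C pl.Q * V))
    (imGamma q S ωs * (Matrix.fromCols pl.Ce pl.Qe * V))
  refine ⟨D, ?_⟩
  have key : ∀ t ∈ Set.Ico 0 τ,
      Sum.elim (derivWithin ζ (Set.Ici t) t) (derivWithin η (Set.Ici t) t) =
        augMatrix pl S F L H Pi ωs *ᵥ Sum.elim (ζ t) (η t) + augInput q S G *ᵥ u t
          + D *ᵥ χ t := by
    intro t ht
    have ht' : t ∈ Set.Icc 0 τ := ⟨ht.1, ht.2.le⟩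
    have hu : UniqueDiffWithinAt ℝ (Set.Ici t) t := uniqueDiffOn_Ici t t Set.self_mem_Ici
    rw [(hζ'.hasDerivWithinAt_Ici_of_Icc ht).derivWithin hu,
      (hη.2.hasDerivWithinAt_Ici_of_Icc ht).derivWithin hu, hC t ht', hCe t ht', augMatrix,
      augInput, Matrix.fromBlocks_mulVec, Matrix.fromRows_mulVec, Matrix.fromRows_mulVec,
      Sum.elim_comp_inl, Sum.elim_comp_inr]
    simp only [Matrix.mulVec_add, Matrix.add_mulVec, Matrix.zero_mulVec, add_zero,
      ← Matrix.mulVec_mulVec]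
    ext (i | i) <;>
      simp only [Sum.elim_inl, Sum.elim_inr, _root_.Pi.add_apply, _root_.Pi.zero_apply] <;> ring
  ext i k
  have hk : (k : ℝ) * (τ / N) ∈ Set.Ico 0 τ := by
    have hkN : (k : ℝ) < N := by exact_mod_cast k.isLt
    have hN : (0 : ℝ) < N := lt_of_le_of_lt (Nat.cast_nonneg _) hkN
    refine ⟨by positivity, ?_⟩
    rw [← mul_div_assoc, div_lt_iff₀ hN, mul_comm]
    gcongr
  have hcol : (fun i => Matrix.fromRows (batch N τ ζ) (batch N τ η) i k) =
      Sum.elim (ζ (k * (τ / N))) (η (k * (τ / N))) := by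
    ext (i | i) <;> rfl
  have hk' := congrFun (key _ hk) i
  rw [← hcol] at hk'
  refine Eq.trans ?_ hk'
  cases i <;> rfl

end Data

/-! ### Closed loop and output regulation -/

section ClosedLoop

variable {n m q r l μ : ℕ}

/-- The matrix `[Π  0]`, mapping the controller state to an estimate of the plant state. -/
def estimateMatrix (q d : ℕ) (Pi : Matrix (Fin n) (Fin μ) ℝ) :
    Matrix (Fin n) (Fin μ ⊕ Fin q × Fin d) ℝ :=
  Matrix.fromCols Pi 0

variable {pl : Plant n m q r l} {S : Matrix (Fin l) (Fin l) ℝ}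
  {F : Matrix (Fin μ) (Fin μ) ℝ} {G : Matrix (Fin μ) (Fin m) ℝ}
  {L : Matrix (Fin μ) (Fin q ⊕ Fin r) ℝ} {H : Matrix (Fin q ⊕ Fin r) (Fin μ) ℝ}
  {Pi : Matrix (Fin n) (Fin μ) ℝ} {ωs : ℝ}
  {K : Matrix (Fin m) (Fin μ ⊕ Fin q × Fin (minDeg S)) ℝ}

theorem regulator_Bc_mul_fromRows {ι : Type*} (Y : Matrix (Fin q) ι ℝ) (Y' : Matrix (Fin r) ι ℝ) :
    (regulator F G L S ωs K).Bc * Matrix.fromRows Y Y' =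
      Matrix.fromRows (L * Matrix.fromRows Y Y') (imGamma q S ωs * Y) := by
  rw [regulator, Matrix.fromBlocks_mul_fromRows, ← Matrix.fromCols_mul_fromRows,
    Matrix.fromCols_toCols, Matrix.zero_mul, add_zero]

/-- On `x = Π ζ`, `w = 0` the controller reproduces the extended realization under the feedback `K`;
this is the lower right block of the closed loop. -/
theorem regulator_Ac_add (hreal : IsCanonicalRealization pl F G L H Pi) :
    (regulator F G L S ωs K).Ac
        + (regulator F G L S ωs K).Bc * pl.C * estimateMatrix q (minDeg S) Pi =
      augMatrix pl S F L H Pi ωs + augInput q S G * K := by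
  have hK : augInput q S G * K =
      Matrix.fromBlocks (G * K.toCols₁) (G * K.toCols₂) 0 0 := by
    conv_lhs => rw [← Matrix.fromCols_toCols K]
    rw [augInput, Matrix.fromRows_mul_fromCols, Matrix.zero_mul, Matrix.zero_mul]
  rw [hK, augMatrix, hreal.output, Plant.C, regulator_Bc_mul_fromRows, estimateMatrix,
    Matrix.fromRows_mul_fromCols, regulator, Matrix.fromBlocks_add, Matrix.fromBlocks_add,
    Matrix.mul_zero, Matrix.mul_zero, Matrix.mul_assoc, Matrix.mul_assoc]
  congr 1 <;> abel

theorem estimateMatrix_mul_regulator_Ac (hreal : IsCanonicalRealization pl F G L H Pi) :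
    estimateMatrix q (minDeg S) Pi * (regulator F G L S ωs K).Ac =
      errorMatrix pl L Pi * estimateMatrix q (minDeg S) Pi + pl.B * K := by
  conv_rhs => rw [← Matrix.fromCols_toCols K]
  rw [estimateMatrix, regulator, Matrix.fromCols_mul_fromBlocks, Matrix.mul_fromCols,
    Matrix.mul_fromCols, hreal.errorMatrix_mul, ← hreal.input]
  ext i (j | j) <;> simp [Matrix.mul_add, Matrix.mul_assoc]

theorem estimateMatrix_mul_regulator_Bc :
    estimateMatrix q (minDeg S) Pi * (regulator F G L S ωs K).Bc = Pi * L := by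
  rw [estimateMatrix, regulator, Matrix.fromCols_mul_fromBlocks, Matrix.zero_mul, Matrix.zero_mul,
    add_zero, add_zero, ← Matrix.mul_fromCols, Matrix.fromCols_toCols]

/-- The closed-loop matrix in the coordinates `(x - Π ζ, ξ)`. -/
def closedLoopMatrix (pl : Plant n m q r l) (S : Matrix (Fin l) (Fin l) ℝ)
    (F : Matrix (Fin μ) (Fin μ) ℝ) (G : Matrix (Fin μ) (Fin m) ℝ)
    (L : Matrix (Fin μ) (Fin q ⊕ Fin r) ℝ) (H : Matrix (Fin q ⊕ Fin r) (Fin μ) ℝ)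
    (Pi : Matrix (Fin n) (Fin μ) ℝ) (ωs : ℝ)
    (K : Matrix (Fin m) (Fin μ ⊕ Fin q × Fin (minDeg S)) ℝ) :
    Matrix (Fin n ⊕ (Fin μ ⊕ Fin q × Fin (minDeg S)))
      (Fin n ⊕ (Fin μ ⊕ Fin q × Fin (minDeg S))) ℝ :=
  Matrix.fromBlocks (errorMatrix pl L Pi) 0 ((regulator F G L S ωs K).Bc * pl.C)
    (augMatrix pl S F L H Pi ωs + augInput q S G * K)

/-- The input matrix from the exosystem to the closed loop in the coordinates `(x - Π ζ, ξ)`. -/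
def closedLoopInput (pl : Plant n m q r l) (S : Matrix (Fin l) (Fin l) ℝ)
    (F : Matrix (Fin μ) (Fin μ) ℝ) (G : Matrix (Fin μ) (Fin m) ℝ)
    (L : Matrix (Fin μ) (Fin q ⊕ Fin r) ℝ) (Pi : Matrix (Fin n) (Fin μ) ℝ) (ωs : ℝ)
    (K : Matrix (Fin m) (Fin μ ⊕ Fin q × Fin (minDeg S)) ℝ) :
    Matrix (Fin n ⊕ (Fin μ ⊕ Fin q × Fin (minDeg S))) (Fin l) ℝ :=
  Matrix.fromRows (errorInput pl L Pi) ((regulator F G L S ωs K).Bc * pl.Q)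

/-- The regulated output matrix in the coordinates `(x - Π ζ, ξ)`. -/
def closedLoopOutput (pl : Plant n m q r l) (d : ℕ) (Pi : Matrix (Fin n) (Fin μ) ℝ) :
    Matrix (Fin q) (Fin n ⊕ (Fin μ ⊕ Fin q × Fin d)) ℝ :=
  Matrix.fromCols pl.Ce (pl.Ce * estimateMatrix q d Pi)

theorem closedLoop_dynamics (hreal : IsCanonicalRealization pl F G L H Pi)
    {w : ℝ → Fin l → ℝ} {x : ℝ → Fin n → ℝ} {ξ : ℝ → Fin μ ⊕ Fin q × Fin (minDeg S) → ℝ}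
    (h : IsClosedLoop pl S (regulator F G L S ωs K) w x ξ) :
    SolvesOn (Set.Ici 0) w (fun t => S *ᵥ w t) ∧
    SolvesOn (Set.Ici 0)
      (fun t => Sum.elim (x t - estimateMatrix q (minDeg S) Pi *ᵥ ξ t) (ξ t))
      (fun t => closedLoopMatrix pl S F G L H Pi ωs K *ᵥ
          Sum.elim (x t - estimateMatrix q (minDeg S) Pi *ᵥ ξ t) (ξ t)
        + closedLoopInput pl S F G L Pi ωs K *ᵥ w t) := by
  obtain ⟨u, y, hy, hu, hw, hx, hξ⟩ := h
  refine ⟨hw, ((hx.sub (hξ.mulVec (estimateMatrix q (minDeg S) Pi))).sumElim hξ).congr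
    fun t _ => ?_⟩
  have hu' : u t = K *ᵥ ξ t := by
    rw [hu, regulator]; simp
  rw [hu', hy, pl.sumElim_regOut_resOut, closedLoopMatrix, closedLoopInput,
    Matrix.fromBlocks_mulVec, Matrix.fromRows_mulVec, Sum.elim_comp_inl, Sum.elim_comp_inr,
    ← regulator_Ac_add hreal]
  have h1 : pl.A *ᵥ x t + pl.B *ᵥ (K *ᵥ ξ t) + pl.P *ᵥ w t
      - estimateMatrix q (minDeg S) Pi *ᵥ ((regulator F G L S ωs K).Ac *ᵥ ξ t
        + (regulator F G L S ωs K).Bc *ᵥ (pl.C *ᵥ x t + pl.Q *ᵥ w t)) =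
      errorMatrix pl L Pi *ᵥ (x t - estimateMatrix q (minDeg S) Pi *ᵥ ξ t)
        + errorInput pl L Pi *ᵥ w t := by
    rw [Matrix.mulVec_add, Matrix.mulVec_mulVec _ (estimateMatrix q (minDeg S) Pi),
      Matrix.mulVec_mulVec _ (estimateMatrix q (minDeg S) Pi),
      estimateMatrix_mul_regulator_Ac hreal, estimateMatrix_mul_regulator_Bc, errorInput]
    simp only [errorMatrix, Matrix.sub_mulVec, Matrix.add_mulVec, Matrix.mulVec_add,
      Matrix.mulVec_sub, ← Matrix.mulVec_mulVec]
    abel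
  have h2 : (regulator F G L S ωs K).Ac *ᵥ ξ t
        + (regulator F G L S ωs K).Bc *ᵥ (pl.C *ᵥ x t + pl.Q *ᵥ w t) =
      ((regulator F G L S ωs K).Bc * pl.C) *ᵥ (x t - estimateMatrix q (minDeg S) Pi *ᵥ ξ t)
        + ((regulator F G L S ωs K).Ac
          + (regulator F G L S ωs K).Bc * pl.C * estimateMatrix q (minDeg S) Pi) *ᵥ ξ t
        + ((regulator F G L S ωs K).Bc * pl.Q) *ᵥ w t := by
    simp only [Matrix.add_mulVec, Matrix.mulVec_add, Matrix.mulVec_sub, ← Matrix.mulVec_mulVec]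
    abel
  rw [h1, h2, Matrix.zero_mulVec, add_zero]
  ext (i | i) <;> rfl

theorem regOut_eq_closedLoopOutput (x : Fin n → ℝ) (w : Fin l → ℝ) {d : ℕ}
    (ξ : Fin μ ⊕ Fin q × Fin d → ℝ) :
    pl.regOut x w = closedLoopOutput pl d Pi *ᵥ
      Sum.elim (x - estimateMatrix q d Pi *ᵥ ξ) ξ + pl.Qe *ᵥ w := by
  rw [closedLoopOutput, Matrix.fromCols_mulVec_sumElim, Matrix.mulVec_sub, Matrix.mulVec_mulVec,
    sub_add_cancel, Plant.regOut]

theorem imPhi_mul_apply (S : Matrix (Fin l) (Fin l) ℝ) {ι : Type*}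
    (R : Matrix (Fin q × Fin (minDeg S)) ι ℝ) (a : Fin q) (i : Fin (minDeg S)) (b : ι) :
    (imPhi q S * R) (a, i) b =
      (minCompanion S * Matrix.of fun (i : Fin (minDeg S)) b => R (a, i) b) i b := by
  simp only [Matrix.mul_apply, Fintype.sum_prod_type, imPhi, Matrix.kroneckerMap_apply]
  rw [Finset.sum_eq_single a]
  · simp
  · intro c _ hc
    simp [Matrix.one_apply_ne' hc]
  · simp

theorem imGamma_mul_apply (S : Matrix (Fin l) (Fin l) ℝ) (ω : ℝ) {ι : Type*}
    (E : Matrix (Fin q) ι ℝ) (a : Fin q) (i : Fin (minDeg S)) (b : ι) :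
    (imGamma q S ω * E) (a, i) b = lastVec (minDeg S) ω i * E a b := by
  simp [Matrix.mul_apply, imGamma_apply]

/-- The internal model property of `(Φ, Γ)`. -/
theorem eq_zero_of_imPhi_mul (hωs : ωs ≠ 0) (R : Matrix (Fin q × Fin (minDeg S)) (Fin l) ℝ)
    (E : Matrix (Fin q) (Fin l) ℝ) (h : R * S = imPhi q S * R + imGamma q S ωs * E) : E = 0 := by
  ext a b
  refine congrFun (eq_zero_of_minCompanion_mul S hωs (Matrix.of fun i b => R (a, i) b) (E a) ?_) b
  ext i b
  have := congrFun (congrFun h (a, i)) b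
  rw [Matrix.add_apply, imPhi_mul_apply, imGamma_mul_apply] at this
  exact this

/-- The last block row of the closed-loop equations is the internal model. -/
theorem fromCols_mul_closedLoop :
    (Matrix.fromCols 0 (Matrix.fromCols 0 1) : Matrix (Fin q × Fin (minDeg S))
        (Fin n ⊕ (Fin μ ⊕ Fin q × Fin (minDeg S))) ℝ) * closedLoopMatrix pl S F G L H Pi ωs K =
      imGamma q S ωs * closedLoopOutput pl (minDeg S) Pi
        + imPhi q S * (Matrix.fromCols 0 (Matrix.fromCols 0 1) : Matrix (Fin q × Fin (minDeg S))
        (Fin n ⊕ (Fin μ ⊕ Fin q × Fin (minDeg S))) ℝ) ∧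
    (Matrix.fromCols 0 (Matrix.fromCols 0 1) : Matrix (Fin q × Fin (minDeg S))
        (Fin n ⊕ (Fin μ ⊕ Fin q × Fin (minDeg S))) ℝ) * closedLoopInput pl S F G L Pi ωs K =
      imGamma q S ωs * pl.Qe := by
  constructor
  · rw [closedLoopMatrix, Matrix.fromCols_mul_fromBlocks, Plant.C, regulator_Bc_mul_fromRows,
      Matrix.fromCols_mul_fromRows, augMatrix, augInput, Matrix.mul_add,
      Matrix.fromCols_mul_fromBlocks, Matrix.fromRows_mul, Matrix.fromCols_mul_fromRows,
      closedLoopOutput, estimateMatrix, Matrix.mul_fromCols, Matrix.mul_fromCols,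
      Matrix.mul_fromCols, Matrix.mul_fromCols, Matrix.mul_fromCols]
    ext i (j | j | j) <;> simp
  · rw [closedLoopInput, Matrix.fromCols_mul_fromRows, Plant.Q, regulator_Bc_mul_fromRows,
      Matrix.fromCols_mul_fromRows]
    simp

theorem exists_norm_mulVec_le {ι κ : Type*} [Fintype ι] [Fintype κ] (M : Matrix ι κ ℝ) :
    ∃ C : ℝ, 0 ≤ C ∧ ∀ v, ‖M *ᵥ v‖ ≤ C * ‖v‖ :=
  let f : (κ → ℝ) →L[ℝ] (ι → ℝ) := LinearMap.toContinuousLinearMap M.mulVecLin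
  ⟨‖f‖, norm_nonneg _, f.le_opNorm⟩

theorem norm_sumElim {ι κ : Type*} [Fintype ι] [Fintype κ] (v : ι → ℝ) (v' : κ → ℝ) :
    ‖Sum.elim v v'‖ = max ‖v‖ ‖v'‖ := by
  apply le_antisymm
  · rw [pi_norm_le_iff_of_nonneg (le_max_of_le_left (norm_nonneg _))]
    rintro (i | i)
    · exact (norm_le_pi_norm v i).trans (le_max_left _ _)
    · exact (norm_le_pi_norm v' i).trans (le_max_right _ _)
  · apply max_le <;> rw [pi_norm_le_iff_of_nonneg (norm_nonneg _)] <;> intro i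
    · exact norm_le_pi_norm (Sum.elim v v') (Sum.inl i)
    · exact norm_le_pi_norm (Sum.elim v v') (Sum.inr i)

/-- The shear `(x, ξ) ↦ (x - J ξ, ξ)` and its inverse are bounded, so exponential estimates carry
over between the two coordinate systems. -/
theorem exists_norm_estimate {ι κ : Type*} [Fintype ι] [Fintype κ] (J : Matrix ι κ ℝ) :
    ∃ C : ℝ, 0 < C ∧ ∀ (x : ι → ℝ) (ξ : κ → ℝ),
      ‖(x, ξ)‖ ≤ C * ‖Sum.elim (x - J *ᵥ ξ) ξ‖ ∧ ‖Sum.elim (x - J *ᵥ ξ) ξ‖ ≤ C * ‖(x, ξ)‖ := by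
  obtain ⟨C, hC, hJ⟩ := exists_norm_mulVec_le J
  refine ⟨C + 1, by positivity, fun x ξ => ?_⟩
  rw [norm_sumElim, Prod.norm_mk]
  constructor
  · have h1 : ‖x‖ ≤ ‖x - J *ᵥ ξ‖ + C * ‖ξ‖ := by
      calc ‖x‖ = ‖(x - J *ᵥ ξ) + J *ᵥ ξ‖ := by rw [sub_add_cancel]
        _ ≤ _ := (norm_add_le _ _).trans (by gcongr; exact hJ ξ)
    set a := max ‖x - J *ᵥ ξ‖ ‖ξ‖
    have h2 : ‖x - J *ᵥ ξ‖ ≤ a := le_max_left _ _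
    have h3 : ‖ξ‖ ≤ a := le_max_right _ _
    have h4 := mul_le_mul_of_nonneg_left h3 hC
    have h5 : 0 ≤ C * a := mul_nonneg hC ((norm_nonneg _).trans h3)
    apply max_le <;> linarith
  · have h1 : ‖x - J *ᵥ ξ‖ ≤ ‖x‖ + C * ‖ξ‖ := (norm_sub_le _ _).trans (by gcongr; exact hJ ξ)
    set a := max ‖x‖ ‖ξ‖
    have h2 : ‖x‖ ≤ a := le_max_left _ _
    have h3 : ‖ξ‖ ≤ a := le_max_right _ _
    have h4 := mul_le_mul_of_nonneg_left h3 hC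
    have h5 : 0 ≤ C * a := mul_nonneg hC ((norm_nonneg _).trans h3)
    apply max_le <;> linarith

/-- A stabilizing gain for the realization extended by the internal model solves the output
regulation problem. -/
theorem solvesOutputRegulation (hctrb : IsControllable pl.A pl.B) (hS : IsNeutrallyStable S)
    (hreal : IsCanonicalRealization pl F G L H Pi) (hωs : ωs ≠ 0)
    (hK : IsHurwitz (augMatrix pl S F L H Pi ωs + augInput q S G * K)) :
    SolvesOutputRegulation pl S (regulator F G L S ωs K) := by
  have hT : IsHurwitz (closedLoopMatrix pl S F G L H Pi ωs K) :=
    isHurwitz_fromBlocks (hreal.isHurwitz_errorMatrix hctrb) hK _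
  constructor
  · obtain ⟨M, lam, hM, hlam, hdecay⟩ := hT.exists_decay
    obtain ⟨C, hC, hnorm⟩ := exists_norm_estimate (estimateMatrix q (minDeg S) Pi)
    refine ⟨C * M * C, lam, by positivity, hlam, fun x ξ h t ht => ?_⟩
    have hz := (closedLoop_dynamics hreal h).2.congr
      (v' := fun t => closedLoopMatrix pl S F G L H Pi ωs K *ᵥ
        Sum.elim (x t - estimateMatrix q (minDeg S) Pi *ᵥ ξ t) (ξ t))
      fun t _ => by rw [Matrix.mulVec_zero, add_zero]
    have h1 := hdecay _ hz t ht
    calc ‖(x t, ξ t)‖ ≤ C * ‖Sum.elim (x t - estimateMatrix q (minDeg S) Pi *ᵥ ξ t) (ξ t)‖ :=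
          (hnorm _ _).1
      _ ≤ C * (M * Real.exp (-lam * t) * (C * ‖(x 0, ξ 0)‖)) := by
          gcongr
          exact h1.trans (by gcongr; exact (hnorm _ _).2)
      _ = C * M * C * Real.exp (-lam * t) * ‖(x 0, ξ 0)‖ := by ring
  · intro w x ξ h
    obtain ⟨hw, hz⟩ := closedLoop_dynamics hreal h
    -- The steady state is `V w`. Below, the internal-model rows of the Sylvester equation show that
    -- its regulated output is zero, without solving for `V`.
    obtain ⟨V, hV⟩ := exists_sylvester hS hT (closedLoopInput pl S F G L Pi ωs K)
    have hE : closedLoopOutput pl (minDeg S) Pi * V + pl.Qe = 0 := by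
      obtain ⟨h1, h2⟩ := fromCols_mul_closedLoop (pl := pl) (S := S) (F := F) (G := G) (L := L)
        (H := H) (Pi := Pi) (ωs := ωs) (K := K)
      apply eq_zero_of_imPhi_mul hωs ((Matrix.fromCols 0 (Matrix.fromCols 0 1) :
        Matrix (Fin q × Fin (minDeg S)) (Fin n ⊕ (Fin μ ⊕ Fin q × Fin (minDeg S))) ℝ) * V)
      rw [Matrix.mul_assoc, ← hV, Matrix.mul_add, ← Matrix.mul_assoc, h1, h2, Matrix.add_mul,
        Matrix.mul_add, Matrix.mul_assoc, Matrix.mul_assoc]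
      abel
    have hd := (hz.sub (hw.mulVec V)).congr
      (v' := fun t => closedLoopMatrix pl S F G L H Pi ωs K *ᵥ
        (Sum.elim (x t - estimateMatrix q (minDeg S) Pi *ᵥ ξ t) (ξ t) - V *ᵥ w t))
      fun t _ => by
        rw [Matrix.mulVec_mulVec, ← hV, Matrix.add_mulVec, Matrix.mulVec_sub,
          Matrix.mulVec_mulVec]
        abel
    have hlim := hT.tendsto_zero hd
    have hcont : Continuous fun v => closedLoopOutput pl (minDeg S) Pi *ᵥ v := by fun_prop
    have hlim' := (hcont.tendsto 0).comp hlim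
    rw [Matrix.mulVec_zero] at hlim'
    refine hlim'.congr fun t => ?_
    have hE' := congrArg (· *ᵥ w t) hE
    simp only [Matrix.add_mulVec, Matrix.zero_mulVec, ← Matrix.mulVec_mulVec] at hE'
    rw [Function.comp_apply, Matrix.mulVec_sub, regOut_eq_closedLoopOutput (Pi := Pi) _ _ (ξ t),
      eq_neg_of_add_eq_zero_left hE', sub_neg_eq_add]

end ClosedLoop

/-! ### From the matrix inequality to the Lyapunov inequality and back -/

section LMI

variable {ι κ : Type*} [Fintype ι] [Fintype κ]

theorem posDef_neg_add_transpose_iff {M : Matrix κ κ ℝ} :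
    (-(M + Mᵀ)).PosDef ↔ NegForm M := by
  have hform : ∀ v, v ⬝ᵥ (-(M + Mᵀ)) *ᵥ v = -(2 * (v ⬝ᵥ M *ᵥ v)) := fun v => by
    rw [Matrix.neg_mulVec, Matrix.add_mulVec, dotProduct_neg, dotProduct_add,
      Matrix.mulVec_transpose, dotProduct_comm v (v ᵥ* _), ← Matrix.dotProduct_mulVec]
    ring
  constructor
  · intro h v hv
    have := h.dotProduct_mulVec_pos hv
    rw [star_trivial, hform] at this
    linarith
  · intro h
    refine Matrix.PosDef.of_dotProduct_mulVec_pos ?_ fun v hv => ?_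
    · rw [Matrix.IsHermitian, Matrix.conjTranspose_eq_transpose_of_trivial]
      simp [add_comm]
    · rw [star_trivial, hform]
      linarith [h v hv]

/-- With `R` a right inverse of the data matrix, `Q = R col(0, P, Y)` has `X Q = 0`, `Z Q = P`, `U Q
= Y`. Hence `dZ Q = A P + B Y`. -/
theorem exists_isLMISolution [DecidableEq ι] [DecidableEq κ] {m N : ℕ}
    {A : Matrix κ κ ℝ} {B : Matrix κ (Fin m) ℝ} {D : Matrix κ ι ℝ} {X : Matrix ι (Fin N) ℝ}
    {Z dZ : Matrix κ (Fin N) ℝ} {U : Matrix (Fin m) (Fin N) ℝ}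
    (hdZ : dZ = A * Z + B * U + D * X)
    (hrank : (Matrix.fromRows (Matrix.fromRows X Z) U).rank = Fintype.card ((ι ⊕ κ) ⊕ Fin m))
    {P : Matrix κ κ ℝ} {Y : Matrix (Fin m) κ ℝ} (hP : P.PosDef) (hneg : NegForm (A * P + B * Y)) :
    ∃ (P : Matrix κ κ ℝ) (Q : Matrix (Fin N) κ ℝ), IsLMISolution X Z dZ P Q := by
  obtain ⟨R, hR⟩ := exists_right_inverse_of_rank _ hrank
  have hQ := congrArg (· * Matrix.fromRows (Matrix.fromRows (0 : Matrix ι κ ℝ) P) Y) hR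
  simp only [Matrix.one_mul, Matrix.mul_assoc] at hQ
  set Q := R * Matrix.fromRows (Matrix.fromRows (0 : Matrix ι κ ℝ) P) Y
  rw [Matrix.fromRows_mul, Matrix.fromRows_mul, Matrix.fromRows_ext_iff,
    Matrix.fromRows_ext_iff] at hQ
  obtain ⟨⟨hXQ, hZQ⟩, hUQ⟩ := hQ
  refine ⟨P, Q, (PosDef.transpose_eq hP).symm, hP, ?_, ?_⟩
  · rw [← Matrix.transpose_mul, posDef_neg_add_transpose_iff, hdZ, Matrix.add_mul, Matrix.add_mul,
      Matrix.mul_assoc, Matrix.mul_assoc, Matrix.mul_assoc, hXQ, hZQ, hUQ, Matrix.mul_zero,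
      add_zero]
    exact hneg
  · rw [Matrix.fromRows_mul, hXQ, hZQ]

/-- The unknown `D` drops out through `X Q = 0`, and `U Q = K P` turns `dZ Q` into `(A + B K) P`. -/
theorem IsLMISolution.isHurwitz [DecidableEq κ] {m N : ℕ}
    {A : Matrix κ κ ℝ} {B : Matrix κ (Fin m) ℝ} {D : Matrix κ ι ℝ} {X : Matrix ι (Fin N) ℝ}
    {Z dZ : Matrix κ (Fin N) ℝ} {U : Matrix (Fin m) (Fin N) ℝ}
    (hdZ : dZ = A * Z + B * U + D * X) {P : Matrix κ κ ℝ} {Q : Matrix (Fin N) κ ℝ}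
    (h : IsLMISolution X Z dZ P Q) : IsHurwitz (A + B * gain U P Q) := by
  have heq := h.eq
  rw [Matrix.fromRows_mul, Matrix.fromRows_ext_iff] at heq
  obtain ⟨hXQ, hZQ⟩ := heq
  have hdecay := h.decay
  rw [← Matrix.transpose_mul, posDef_neg_add_transpose_iff] at hdecay
  have hinv : P⁻¹ * P = 1 :=
    Matrix.nonsing_inv_mul P ((Matrix.isUnit_iff_isUnit_det P).mp h.posDef.isUnit)
  refine isHurwitz_of_negForm h.posDef ?_
  convert hdecay using 1
  rw [hdZ, Matrix.add_mul, Matrix.add_mul, Matrix.add_mul, Matrix.mul_assoc A, ← hZQ,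
    Matrix.mul_assoc D, ← hXQ, Matrix.mul_zero, add_zero, gain, Matrix.mul_assoc B,
    Matrix.mul_assoc (U * Q), hinv, Matrix.mul_one, Matrix.mul_assoc B]

end LMI

end DataDrivenRegulation

end

theorem theorem2 {n m q r l μ N : ℕ}
    (pl : Plant n m q r l) (S : Matrix (Fin l) (Fin l) ℝ)
    (hctrb : IsControllable pl.A pl.B) (hobs : IsObservable pl.C pl.A)
    (hS : IsNeutrallyStable S) (hres : NonResonance pl S)
    (τ : ℝ) (hτ : 0 < τ) (hN : 1 ≤ N)
    (u : ℝ → Fin m → ℝ) (e : ℝ → Fin q → ℝ) (yr : ℝ → Fin r → ℝ)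
    (hdata : IsDataset pl S τ u e yr)
    (F : Matrix (Fin μ) (Fin μ) ℝ) (G : Matrix (Fin μ) (Fin m) ℝ)
    (L : Matrix (Fin μ) (Fin q ⊕ Fin r) ℝ)
    (H : Matrix (Fin q ⊕ Fin r) (Fin μ) ℝ) (Pi : Matrix (Fin n) (Fin μ) ℝ)
    (hreal : IsCanonicalRealization pl F G L H Pi)
    (ωs ωf : ℝ) (hωs : ωs ≠ 0) (hωf : ωf ≠ 0)
    (ζ : ℝ → Fin μ → ℝ) (hζ : IsFilterState F G L τ u e yr ζ)
    (η : ℝ → Fin q × Fin (minDeg S) → ℝ) (hη : IsInternalModelState S ωs τ e η)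
    (χ : ℝ → Fin (minDeg S) ⊕ Fin (minDeg F) → ℝ) (hχ : IsAuxState S F ωs ωf τ χ)
    (U : Matrix (Fin m) (Fin N) ℝ) (hU : U = batch N τ u)
    (X : Matrix (Fin (minDeg S) ⊕ Fin (minDeg F)) (Fin N) ℝ) (hX : X = batch N τ χ)
    (Z dZ : Matrix (Fin μ ⊕ Fin q × Fin (minDeg S)) (Fin N) ℝ)
    (hZ : Z = Matrix.fromRows (batch N τ ζ) (batch N τ η))
    (hdZ : dZ = Matrix.fromRows (batchDeriv N τ ζ) (batchDeriv N τ η)) :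
    ((Matrix.fromRows (Matrix.fromRows X Z) U).rank
        = (minDeg S + minDeg F) + (μ + minDeg S * q) + m →
      ∃ (P : Matrix (Fin μ ⊕ Fin q × Fin (minDeg S)) (Fin μ ⊕ Fin q × Fin (minDeg S)) ℝ)
        (Q : Matrix (Fin N) (Fin μ ⊕ Fin q × Fin (minDeg S)) ℝ),
        IsLMISolution X Z dZ P Q) ∧
    (∀ (P : Matrix (Fin μ ⊕ Fin q × Fin (minDeg S)) (Fin μ ⊕ Fin q × Fin (minDeg S)) ℝ)
       (Q : Matrix (Fin N) (Fin μ ⊕ Fin q × Fin (minDeg S)) ℝ),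
      IsLMISolution X Z dZ P Q →
        IsHurwitz
          (Matrix.fromBlocks (F + L * H) 0 (imGamma q S ωs * (pl.Ce * Pi)) (imPhi q S)
            + Matrix.fromRows G (0 : Matrix (Fin q × Fin (minDeg S)) (Fin m) ℝ)
              * gain U P Q) ∧
        SolvesOutputRegulation pl S (regulator F G L S ωs (gain U P Q))) := by
  subst hU hX hZ hdZ
  obtain ⟨D, hD⟩ := exists_batchDeriv_eq (N := N) hctrb hS hτ hdata hreal hωs hωf hζ hη hχ
  refine ⟨fun hrank => ?_, fun P Q hPQ => ?_⟩
  · obtain ⟨P, Y, hP, hneg⟩ := exists_posDef_negForm (augMatrix pl S F L H Pi ωs)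
      (augInput q S G) fun s hs y hA hB => augMatrix_stabilizable hctrb hres hreal hωs hs hA hB
    refine exists_isLMISolution hD (hrank.trans ?_) hP hneg
    simp [mul_comm]
  · have hK := hPQ.isHurwitz hD
    exact ⟨hK, solvesOutputRegulation hctrb hS hreal hωs hK⟩
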